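/- Let $G$ be a finite simple graph and let $k$ be a positive integer. The $k$-Stirling colour graph $\mathcal{S}_k(G)$ of $G$ is the graph whose vertices are the partitions of $V(G)$ into exactly $k$ non-empty independent sets, where two different partitions $p_1$ and $p_2$ are adjacent if and only if there is a vertex $x\in V(G)$ such that the restrictions of $p_1$ and $p_2$ to $V(G)\setminus\{x\}$ are equal. (The restriction of a partition to $V(G)\setminus\{x\}$ is obtained by deleting $x$ from its cell and discarding that cell if it becomes empty.) **Theorem.** For every finite tree $T$ with at least $5$ vertices, the $4$-Stirling colour graph $\mathcal{S}_4(T)$ is Hamiltonian, that is, it contains a cycle that passes through every vertex of $\mathcal{S}_4(T)$ exactly once. -/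

import Mathlib

/-- The colourings of `G` with exactly `k` colours, viewed as partitions of the vertex set:
partitions of `V(G)` into exactly `k` (nonempty) independent sets. -/
abbrev StirlingColouring {V : Type*} [Fintype V] [DecidableEq V] (G : SimpleGraph V) (k : ℕ) :
    Type _ :=
  {P : Finpartition (Finset.univ : Finset V) //
    P.parts.card = k ∧ ∀ s ∈ P.parts, G.IsIndepSet (s : Set V)}

/-- The `k`-Stirling colour graph `S_k(G)`. Its vertices are the partitions of `V(G)` into exactly
`k` independent sets; two different partitions are adjacent if, for some vertex `x`, their
restrictions to `V(G) - {x}` (remove `x` from its cell and discard the cell if it becomes empty)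
are equal. -/
def stirlingColourGraph {V : Type*} [Fintype V] [DecidableEq V] (G : SimpleGraph V) (k : ℕ) :
    SimpleGraph (StirlingColouring G k) where
  Adj P Q := P ≠ Q ∧ ∃ x : V, P.1.avoid {x} = Q.1.avoid {x}
  symm := ⟨fun _ _ h => ⟨h.1.symm, h.2.imp fun _ hx => hx.symm⟩⟩
  loopless := ⟨fun _ h => h.1 rfl⟩

set_option linter.unusedSectionVars false

/-! Partitions are represented by maps to `Fin k` up to renaming of colours, and the tree is grown
leaf by leaf. Suppose that the four-cell partitions of a subtree `W` are listed cyclically, and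
attach a leaf `v` to `u`. A four-cell partition of the larger tree is of one of two kinds
(`enumerates_insert`): deleting `v` leaves four cells, or `v` is alone and the rest is a partition
of `W` into exactly three independent sets.

For the first kind, each partition of `W` has three extensions, which are mutually adjacent.
`triangle_path` threads these triangles along the opened cycle, with both ends in the triangle of
the partition where the cycle was opened. For the second kind, a Hamiltonian path through the
three-cell partitions of `W` is needed (`BellPath`). It runs from the bipartition `b` with `x`
isolated to `b` with `y` isolated. The cycle is opened at `separate b x y`, where both are isolated.
If `v` has joined `y`, moving `y` back to its side of `b` leaves `v` alone and only `x` isolated;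
the roles of `x` and `y` can be exchanged. These two links close the new cycle
(`StirlingCycle.grow`). Since `v` must be allowed to join `x` and `y`, neither may be `u`; hence the
forbidden vertex `z` in `IsSubtree.exists_bellPath`.

The three-colour path is grown by two leaves at a time. One leaf has only two admissible colours,
but two nonadjacent leaves give each colouring a square of four extensions, and `edgePath` threads
the squares so that the path enters and leaves each along one edge. The square of `b` is treated
apart, because one of its corners is the new bipartition, which does not belong to the path.

In both threading arguments, recolouring the neighbour of a new leaf forbids a colour there. By
`no_return` the next recolouring cannot restore the old colour, and this always leaves a legal
route. If both leaves hang from one vertex, the tree is chosen to be a star, whose centre never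
moves (`chain_centre_const`). -/

namespace StirlingGray

/-! ### Hamiltonian paths through a multiset -/

/-- There is an `R`-chain from `p` to `q` passing through the elements of `M`, with multiplicity. -/
def HamPath {α : Type*} (R : α → α → Prop) (p q : α) (M : Multiset α) : Prop :=
  ∃ L : List α, L.IsChain R ∧ L.head? = some p ∧ L.getLast? = some q ∧ (L : Multiset α) = M

namespace HamPath

variable {α : Type*} {R : α → α → Prop} {p q r s : α} {M N : Multiset α}

theorem single (R : α → α → Prop) (p : α) : HamPath R p p {p} :=
  ⟨[p], by simp, by simp, by simp, by simp⟩

theorem append (h : HamPath R p q M) (hqr : R q r) (h' : HamPath R r s N) :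
    HamPath R p s (M + N) := by
  obtain ⟨L, hL, hp, hq, rfl⟩ := h
  obtain ⟨L', hL', hr, hs, rfl⟩ := h'
  refine ⟨L ++ L', ?_, by simp [hp], by simp [hs], by simp⟩
  rw [List.isChain_append]
  refine ⟨hL, hL', ?_⟩
  simp [hq, hr, hqr]

theorem cons (hpq : R p q) (h : HamPath R q r M) : HamPath R p r ({p} + M) :=
  (single R p).append hpq h

theorem snoc (h : HamPath R p q M) (hqr : R q r) : HamPath R p r (M + {r}) :=
  h.append hqr (single R r)

theorem symm (hR : ∀ a b, R a b → R b a) (h : HamPath R p q M) : HamPath R q p M := by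
  obtain ⟨L, hL, hp, hq, rfl⟩ := h
  refine ⟨L.reverse, ?_, by simp [hq], by simp [hp], by simp⟩
  rw [List.isChain_reverse]
  exact hL.imp fun a b => hR a b

theorem congr (h : HamPath R p q M) (hMN : M = N) : HamPath R p q N := hMN ▸ h

end HamPath

/-! ### Colourings up to renaming of the colours -/

variable {V : Type*} [DecidableEq V] {k : ℕ}

/-- `f` and `g` induce the same partition of `W`. -/
def SameKer (W : Finset V) (f g : V → Fin k) : Prop :=
  ∀ ⦃x⦄, x ∈ W → ∀ ⦃y⦄, y ∈ W → (f x = f y ↔ g x = g y)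

/-- The partitions of `W` induced by `f` and `g` agree after deletion of one vertex. -/
def Step (W : Finset V) (f g : V → Fin k) : Prop := ∃ x ∈ W, SameKer (W.erase x) f g

/-- `g` is obtained from `f` by recolouring one vertex. -/
def Move (W : Finset V) (f g : V → Fin k) : Prop := ∃ x ∈ W, ∃ c, g = Function.update f x c

namespace SameKer

variable {W W' : Finset V} {f g h : V → Fin k}

theorem refl (W : Finset V) (f : V → Fin k) : SameKer W f f := fun _ _ _ _ => Iff.rfl

theorem symm (hfg : SameKer W f g) : SameKer W g f := fun _ hx _ hy => (hfg hx hy).symm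

theorem trans (hfg : SameKer W f g) (hgh : SameKer W g h) : SameKer W f h :=
  fun _ hx _ hy => (hfg hx hy).trans (hgh hx hy)

theorem mono (hW : W' ⊆ W) (hfg : SameKer W f g) : SameKer W' f g :=
  fun _ hx _ hy => hfg (hW hx) (hW hy)

theorem of_perm (σ : Equiv.Perm (Fin k)) (h : ∀ x ∈ W, σ (f x) = g x) : SameKer W f g :=
  fun x hx y hy => by rw [← h x hx, ← h y hy, σ.injective.eq_iff]

theorem of_eq (h : ∀ x ∈ W, f x = g x) : SameKer W f g := of_perm (Equiv.refl _) h

/-- The correspondence between colours used on `W` is well defined and injective, so it extends to a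
permutation of the finite palette. -/
theorem exists_perm (hfg : SameKer W f g) :
    ∃ σ : Equiv.Perm (Fin k), ∀ x ∈ W, σ (f x) = g x := by
  rcases W.eq_empty_or_nonempty with rfl | ⟨x₀, -⟩
  · exact ⟨Equiv.refl _, by simp⟩
  have : Nonempty V := ⟨x₀⟩
  have key : ∀ a ∈ W.image f, ∃ x ∈ W, f x = a := fun a ha => by simpa using ha
  choose! e he hea using key
  obtain ⟨σ, hσ⟩ := Finset.exists_equiv_extend_of_card_eq (α := Fin k) (β := Fin k)
    (t := Finset.univ) (by simp) (s := W.image f) (f := fun a => g (e a)) (by simp) (by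
      intro a ha b hb hab
      have := (hfg (he a ha) (he b hb)).2 hab
      rwa [hea a ha, hea b hb] at this)
  refine ⟨σ.trans (Equiv.subtypeUnivEquiv (by simp)), fun x hx => ?_⟩
  have hm : f x ∈ W.image f := Finset.mem_image_of_mem f hx
  have := hσ (f x) hm
  simp only [Equiv.trans_apply, Equiv.subtypeUnivEquiv_apply]
  rw [this]
  exact (hfg (he _ hm) hx).1 (hea _ hm)

theorem card_image (hfg : SameKer W f g) : (W.image f).card = (W.image g).card := by
  obtain ⟨σ, hσ⟩ := hfg.exists_perm
  have : W.image g = (W.image f).map σ.toEmbedding := by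
    ext a
    simp only [Finset.mem_image, Finset.mem_map, Equiv.coe_toEmbedding]
    constructor
    · rintro ⟨x, hx, rfl⟩
      exact ⟨f x, ⟨x, hx, rfl⟩, hσ x hx⟩
    · rintro ⟨_, ⟨x, hx, rfl⟩, rfl⟩
      exact ⟨x, hx, (hσ x hx).symm⟩
  rw [this, Finset.card_map]

end SameKer

section Step

variable {W : Finset V} {f g h : V → Fin k}

theorem Step.symm (hfg : Step W f g) : Step W g f := by
  obtain ⟨x, hx, h⟩ := hfg
  exact ⟨x, hx, h.symm⟩

theorem Step.of_eq {x : V} (hx : x ∈ W) (h : ∀ y ∈ W, y ≠ x → f y = g y) : Step W f g :=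
  ⟨x, hx, SameKer.of_eq fun y hy => h y (Finset.mem_of_mem_erase hy) (Finset.ne_of_mem_erase hy)⟩

theorem Step.congr_left (hfg : Step W f g) (hf : SameKer W f h) : Step W h g := by
  obtain ⟨x, hx, h⟩ := hfg
  exact ⟨x, hx, (hf.symm.mono (Finset.erase_subset _ _)).trans h⟩

theorem Step.congr_right (hfg : Step W f g) (hg : SameKer W g h) : Step W f h :=
  (hfg.symm.congr_left hg).symm

theorem Move.step (hfg : Move W f g) : Step W f g := by
  obtain ⟨x, hx, c, rfl⟩ := hfg
  exact Step.of_eq hx fun y _ hy => by simp [hy]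

theorem Move.eq_update {x : V} (hfg : Move W f g) (hx : g x ≠ f x) :
    g = Function.update f x (g x) := by
  obtain ⟨y, -, c, rfl⟩ := hfg
  by_cases h : x = y
  · subst h; simp
  · simp [h] at hx

theorem Move.eq_of_ne {x y : V} (hfg : Move W f g) (hx : g x ≠ f x) (hy : y ≠ x) : g y = f y := by
  rw [hfg.eq_update hx]; simp [hy]

/-- A step can be realised as the recolouring of one vertex, for any choice of the colours of its
first partition. -/
theorem Step.exists_move {f' : V → Fin k} (hfg : Step W f g) (hf : SameKer W f f') :
    ∃ g', Move W f' g' ∧ SameKer W g g' := by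
  obtain ⟨x, hx, h⟩ := hfg
  obtain ⟨σ, hσ⟩ := (h.symm.trans (hf.mono (Finset.erase_subset _ _))).exists_perm
  refine ⟨Function.update f' x (σ (g x)), ⟨x, hx, _, rfl⟩, SameKer.of_perm σ fun y hy => ?_⟩
  by_cases hyx : y = x
  · subst hyx; simp
  · simp [hyx, hσ y (Finset.mem_erase.2 ⟨hyx, hy⟩)]

/-- Renaming the colours of each successive partition turns a path of partitions into a path of
genuine recolourings. The threading arguments need this, since they compare actual colours at a
vertex along the path. -/
theorem exists_moves (f f' : V → Fin k) (l : List (V → Fin k)) (hl : (f :: l).IsChain (Step W))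
    (hf : SameKer W f f') :
    ∃ l', (f' :: l').IsChain (Move W) ∧ List.Forall₂ (SameKer W) l l' := by
  induction l generalizing f f' with
  | nil => exact ⟨[], by simp, by simp⟩
  | cons g l ih =>
    rw [List.isChain_cons_cons] at hl
    obtain ⟨g', hg', hgg⟩ := hl.1.exists_move hf
    obtain ⟨l', hl', hll⟩ := ih g g' hl.2 hgg
    exact ⟨g' :: l', by simp [hg', hl'], by simp [hgg, hll]⟩

end Step

/-! ### Complete lists of partitions -/

/-- `L` contains each partition of `W` induced by a colouring with property `p` exactly once. -/
structure Enumerates (W : Finset V) (p : (V → Fin k) → Prop) (L : List (V → Fin k)) : Prop where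
  mem : ∀ f ∈ L, p f
  pairwise : L.Pairwise fun f g => ¬ SameKer W f g
  complete : ∀ g, p g → ∃ f ∈ L, SameKer W f g

/-- `p` depends only on the partition of `W` induced by a colouring. -/
def KerInvariant (W : Finset V) (p : (V → Fin k) → Prop) : Prop :=
  ∀ ⦃f g⦄, SameKer W f g → p f → p g

namespace Enumerates

variable {W : Finset V} {p : (V → Fin k) → Prop} {L L' : List (V → Fin k)}

theorem perm (hL : Enumerates W p L) (h : L.Perm L') : Enumerates W p L' where
  mem f hf := hL.mem f (h.mem_iff.2 hf)
  pairwise := (h.pairwise_iff fun h h' => h h'.symm).1 hL.pairwise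
  complete g hg := by
    obtain ⟨f, hf, hfg⟩ := hL.complete g hg
    exact ⟨f, h.mem_iff.1 hf, hfg⟩

theorem forall₂ (hp : KerInvariant W p) (hL : Enumerates W p L)
    (h : List.Forall₂ (SameKer W) L L') : Enumerates W p L' where
  mem f hf := by
    obtain ⟨g, hg, hgf⟩ : ∃ g ∈ L, SameKer W g f := by
      clear hL
      induction h with
      | nil => simp at hf
      | cons h _ ih =>
        rcases List.mem_cons.1 hf with rfl | hf
        · exact ⟨_, by simp, h⟩
        · obtain ⟨g, hg, hgf⟩ := ih hf
          exact ⟨g, by simp [hg], hgf⟩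
    exact hp hgf (hL.mem g hg)
  pairwise := by
    have := hL.pairwise
    clear hL
    induction h with
    | nil => simp
    | @cons a b l l' h hll ih =>
      rw [List.pairwise_cons] at this ⊢
      refine ⟨fun c hc hbc => ?_, ih this.2⟩
      obtain ⟨g, hg, hgc⟩ : ∃ g ∈ l, SameKer W g c := by
        clear this ih
        induction hll with
        | nil => simp at hc
        | cons h _ ih =>
          rcases List.mem_cons.1 hc with rfl | hc
          · exact ⟨_, by simp, h⟩
          · obtain ⟨g, hg, hgf⟩ := ih hc
            exact ⟨g, by simp [hg], hgf⟩
      exact this.1 g hg ((h.trans hbc).trans hgc.symm)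
  complete g hg := by
    obtain ⟨f, hf, hfg⟩ := hL.complete g hg
    clear hL
    induction h with
    | nil => simp at hf
    | cons h _ ih =>
      rcases List.mem_cons.1 hf with rfl | hf
      · exact ⟨_, by simp, h.symm.trans hfg⟩
      · obtain ⟨g, hg, hgf⟩ := ih hf
        exact ⟨g, by simp [hg], hgf⟩

end Enumerates

/-! ### Extending colourings to a leaf -/

/-- The colourings that agree with `f` off `v` and give `v` another colour than `u`. -/
def fib (v u : V) (f : V → Fin k) : List (V → Fin k) :=
  ((List.finRange k).filter (· ≠ f u)).map (Function.update f v)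

theorem mem_fib {v u : V} {f g : V → Fin k} :
    g ∈ fib v u f ↔ ∃ c, c ≠ f u ∧ Function.update f v c = g := by
  simp [fib]

theorem sameKer_update {W : Finset V} {v : V} (hv : v ∉ W) (f : V → Fin k) (c : Fin k) :
    SameKer W (Function.update f v c) f :=
  SameKer.of_eq fun x hx => by rw [Function.update_of_ne]; rintro rfl; exact hv hx

/-- By `hcol` at most one colour is missing on `W`. Two colours missing on `W` would give the same
partition when used at `v`; with at most one missing, different colours at `v` give different
partitions. -/
theorem Enumerates.flatMap_fib {W : Finset V} {p : (V → Fin k) → Prop} {L : List (V → Fin k)}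
    (hL : Enumerates W p L) (hp : KerInvariant W p) {v u : V} (hv : v ∉ W) (hu : u ∈ W)
    (hcol : ∀ f, p f → k ≤ (W.image f).card + 1) :
    Enumerates (insert v W) (fun f => p f ∧ f v ≠ f u) (L.flatMap (fib v u)) where
  mem f hf := by
    obtain ⟨g, hg, hf⟩ := List.mem_flatMap.1 hf
    obtain ⟨c, hc, rfl⟩ := mem_fib.1 hf
    have huv : u ≠ v := by rintro rfl; exact hv hu
    exact ⟨hp (sameKer_update hv g c).symm (hL.mem g hg), by simpa [huv] using hc⟩
  pairwise := by
    have huv : u ≠ v := by rintro rfl; exact hv hu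
    rw [List.pairwise_flatMap]
    constructor
    · intro f hf
      rw [fib, List.pairwise_map]
      refine ((List.nodup_finRange k).filter _).imp_of_mem fun {c d} hc hd hcd h => hcd ?_
      have aux : ∀ c d, SameKer (insert v W) (Function.update f v c) (Function.update f v d) →
          c ∈ W.image f → c = d := by
        intro c d h hc
        obtain ⟨y, hy, rfl⟩ := Finset.mem_image.1 hc
        have hyv : y ≠ v := by rintro rfl; exact hv hy
        have := (h (Finset.mem_insert_of_mem hy) (Finset.mem_insert_self v W)).1 (by simp [hyv])
        simpa [hyv] using this
      by_contra hcd
      have hc' : c ∉ W.image f := fun hc => hcd (aux c d h hc)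
      have hd' : d ∉ W.image f := fun hd => hcd (aux d c h.symm hd).symm
      have h1 : (insert c (insert d (W.image f))).card = (W.image f).card + 2 := by
        rw [Finset.card_insert_of_notMem (by simp [hcd] at hc' ⊢; exact hc'),
          Finset.card_insert_of_notMem hd']
      have h2 := Finset.card_le_univ (insert c (insert d (W.image f)))
      have h3 := hcol f (hL.mem f hf)
      simp only [Fintype.card_fin] at h2
      omega
    · refine hL.pairwise.imp fun {f g} hfg a ha b hb hab => hfg ?_
      obtain ⟨c, hc, rfl⟩ := mem_fib.1 ha
      obtain ⟨d, hd, rfl⟩ := mem_fib.1 hb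
      exact ((sameKer_update hv f c).symm.trans (hab.mono (Finset.subset_insert _ _))).trans
        (sameKer_update hv g d)
  complete g hg := by
    obtain ⟨f, hf, hfg⟩ := hL.complete g hg.1
    obtain ⟨σ, hσ⟩ := hfg.symm.exists_perm
    refine ⟨Function.update f v (σ (g v)), List.mem_flatMap.2 ⟨f, hf, mem_fib.2 ⟨_, ?_, rfl⟩⟩, ?_⟩
    · rw [← hσ u hu]
      exact fun h => hg.2 (σ.injective h)
    · refine (SameKer.of_perm σ fun y hy => ?_).symm
      by_cases hyv : y = v
      · subst hyv; simp
      · simp [hyv, hσ y ((Finset.mem_insert.1 hy).resolve_left hyv)]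

variable {T : SimpleGraph V} {W : Finset V} {u v w t z : V}

/-! ### Trees grown leaf by leaf -/

/-- `u` is the only neighbour in `W` of the vertex `v` outside `W`. -/
structure Attach (T : SimpleGraph V) (W : Finset V) (v u : V) : Prop where
  mem : u ∈ W
  notMem : v ∉ W
  adj_iff : ∀ y ∈ W, T.Adj v y ↔ y = u

/-- The vertex sets of subtrees of `T` that can be grown leaf by leaf. -/
inductive IsSubtree (T : SimpleGraph V) : Finset V → Prop
  | single (r : V) : IsSubtree T {r}
  | grow {W : Finset V} {v u : V} (hW : IsSubtree T W) (h : Attach T W v u) :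
      IsSubtree T (insert v W)

/-- `v` is a leaf of the subgraph induced on `W`, with neighbour `u`. -/
structure IsLeaf (T : SimpleGraph V) (W : Finset V) (v u : V) : Prop where
  mem : v ∈ W
  mem' : u ∈ W
  adj_iff : ∀ y ∈ W, T.Adj v y ↔ y = u

theorem Attach.ne (h : Attach T W v u) : v ≠ u := by
  rintro rfl; exact h.notMem h.mem

theorem Attach.adj (h : Attach T W v u) : T.Adj v u := (h.adj_iff u h.mem).2 rfl

theorem IsLeaf.adj (h : IsLeaf T W v u) : T.Adj v u := (h.adj_iff u h.mem').2 rfl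

theorem IsLeaf.ne (h : IsLeaf T W v u) : v ≠ u := h.adj.ne

theorem Attach.isLeaf (h : Attach T W v u) : IsLeaf T (insert v W) v u where
  mem := Finset.mem_insert_self _ _
  mem' := Finset.mem_insert_of_mem h.mem
  adj_iff y hy := by
    rcases Finset.mem_insert.1 hy with rfl | hy
    · simp [h.ne]
    · exact h.adj_iff y hy

theorem IsLeaf.attach (h : IsLeaf T W v u) : Attach T (W.erase v) v u where
  mem := Finset.mem_erase.2 ⟨h.ne.symm, h.mem'⟩
  notMem := Finset.notMem_erase _ _
  adj_iff y hy := h.adj_iff y (Finset.mem_of_mem_erase hy)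

theorem IsLeaf.insert (h : IsLeaf T W w t) (hv : Attach T W v u) (hwu : w ≠ u) :
    IsLeaf T (insert v W) w t where
  mem := Finset.mem_insert_of_mem h.mem
  mem' := Finset.mem_insert_of_mem h.mem'
  adj_iff y hy := by
    rcases Finset.mem_insert.1 hy with rfl | hy
    · rw [T.adj_comm, hv.adj_iff w h.mem]
      have : y ≠ t := by rintro rfl; exact hv.notMem h.mem'
      simp [hwu, this]
    · exact h.adj_iff y hy

theorem IsLeaf.mono {W' : Finset V} (h : IsLeaf T W v u) (hW : W' ⊆ W) (hv : v ∈ W') (hu : u ∈ W') :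
    IsLeaf T W' v u := ⟨hv, hu, fun y hy => h.adj_iff y (hW hy)⟩

theorem IsSubtree.nonempty (hW : IsSubtree T W) : W.Nonempty := by
  cases hW <;> simp

theorem IsSubtree.exists_adj (hW : IsSubtree T W) (hc : 2 ≤ W.card) :
    ∀ x ∈ W, ∃ y ∈ W, T.Adj x y := by
  induction hW with
  | single r => simp at hc
  | @grow W v u hW h ih =>
    intro x hx
    rcases Finset.mem_insert.1 hx with rfl | hx
    · exact ⟨u, Finset.mem_insert_of_mem h.mem, h.adj⟩
    · by_cases hxu : x = u
      · subst hxu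
        exact ⟨v, Finset.mem_insert_self _ _, h.adj.symm⟩
      · have : 2 ≤ W.card := Finset.one_lt_card.2 ⟨x, hx, u, h.mem, hxu⟩
        obtain ⟨y, hy, hxy⟩ := ih this x hx
        exact ⟨y, Finset.mem_insert_of_mem hy, hxy⟩

/-- Deleting `v` commutes with the last attachment unless `v` is the vertex just attached, or that
vertex hangs from `v`. In the latter case the leaf `v` has no other neighbour, so the tree is a
single edge. -/
theorem IsSubtree.erase (hW : IsSubtree T W) (h : IsLeaf T W v u) : IsSubtree T (W.erase v) := by
  induction hW generalizing v u with
  | single r =>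
    have h1 := h.mem; have h2 := h.mem'
    rw [Finset.mem_singleton] at h1 h2
    exact absurd (h1.trans h2.symm) h.ne
  | @grow W x y hW hx ih =>
    by_cases hvx : v = x
    · subst hvx
      rwa [Finset.erase_insert hx.notMem]
    have hv : v ∈ W := (Finset.mem_insert.1 h.mem).resolve_left hvx
    by_cases hvy : v = y
    · subst hvy
      have hux : x = u := (h.adj_iff x (Finset.mem_insert_self _ _)).1 hx.adj.symm
      have hWc : W = {v} := by
        by_contra hne
        have : 2 ≤ W.card := by
          by_contra hlt
          have : W.card = 1 := by
            have := Finset.card_pos.2 hW.nonempty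
            omega
          obtain ⟨a, rfl⟩ := Finset.card_eq_one.1 this
          rw [Finset.mem_singleton] at hv
          exact hne (by rw [hv])
        obtain ⟨a, ha, hva⟩ := hW.exists_adj this v hv
        have := (h.adj_iff a (Finset.mem_insert_of_mem ha)).1 hva
        rw [this, ← hux] at ha
        exact hx.notMem ha
      rw [hWc, Finset.erase_insert_of_ne (Ne.symm hvx), Finset.erase_singleton]
      exact IsSubtree.single x
    · have hu : u ∈ W := by
        refine (Finset.mem_insert.1 h.mem').resolve_left ?_
        rintro rfl
        exact hvy ((hx.adj_iff v hv).1 h.adj.symm)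
      have hl : IsLeaf T W v u := h.mono (Finset.subset_insert _ _) hv hu
      rw [Finset.erase_insert_of_ne (Ne.symm hvx)]
      refine (ih hl).grow (u := y) ⟨Finset.mem_erase.2 ⟨Ne.symm hvy, hx.mem⟩, ?_, ?_⟩
      · exact fun hm => hx.notMem (Finset.mem_of_mem_erase hm)
      · exact fun a ha => hx.adj_iff a (Finset.mem_of_mem_erase ha)

/-- A tree is a star, or it has two nonadjacent leaves with different neighbours. -/
theorem IsSubtree.star_or_leaves (hW : IsSubtree T W) (hc : 2 ≤ W.card) :
    (∃ c ∈ W, ∀ a ∈ W, a ≠ c → IsLeaf T W a c) ∨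
      ∃ v u w t, IsLeaf T W v u ∧ IsLeaf T W w t ∧ u ≠ t ∧ ¬ T.Adj v w := by
  induction hW with
  | single r => simp at hc
  | @grow W x y hW hx ih =>
    by_cases h1 : W.card = 1
    · obtain ⟨a, rfl⟩ := Finset.card_eq_one.1 h1
      have := hx.mem
      rw [Finset.mem_singleton] at this
      subst this
      refine Or.inl ⟨y, by simp, fun a ha hay => ?_⟩
      have : a = x := by simpa [hay] using ha
      subst this
      exact hx.isLeaf
    have h2 : 2 ≤ W.card := by
      have := Finset.card_pos.2 hW.nonempty
      omega
    rcases ih h2 with ⟨c, hc, hstar⟩ | ⟨v, u, w, t, hv, hw, hut, hvw⟩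
    · by_cases hyc : y = c
      · subst hyc
        refine Or.inl ⟨y, Finset.mem_insert_of_mem hc, fun a ha hay => ?_⟩
        rcases Finset.mem_insert.1 ha with rfl | ha
        · exact hx.isLeaf
        · exact (hstar a ha hay).insert hx hay
      · by_cases hl : ∃ l ∈ W, l ≠ c ∧ l ≠ y
        · obtain ⟨l, hl, hlc, hly⟩ := hl
          refine Or.inr ⟨x, y, l, c, hx.isLeaf, (hstar l hl hlc).insert hx hly, hyc, ?_⟩
          rw [hx.adj_iff l hl]
          exact hly
        · push Not at hl
          refine Or.inl ⟨y, Finset.mem_insert_of_mem hx.mem, fun a ha hay => ?_⟩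
          rcases Finset.mem_insert.1 ha with rfl | ha
          · exact hx.isLeaf
          · have hac : a = c := by
              by_contra hac
              exact hay (hl a ha hac)
            subst hac
            refine IsLeaf.insert ⟨ha, hx.mem, fun b hb => ?_⟩ hx hay
            have hya : T.Adj y a := (hstar y hx.mem hyc).adj
            constructor
            · intro hab
              exact hl b hb hab.ne'
            · rintro rfl
              exact hya.symm
    · right
      by_cases hvy : v = y
      · subst hvy
        have hwv : w ≠ v := by
          rintro rfl
          exact hut ((hv.adj_iff t hw.mem').1 hw.adj |>.symm)
        refine ⟨x, v, w, t, hx.isLeaf, hw.insert hx hwv, ?_, ?_⟩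
        · rintro rfl; exact hvw hw.adj.symm
        · rw [hx.adj_iff w hw.mem]; exact hwv
      · by_cases hwy : w = y
        · subst hwy
          refine ⟨v, u, x, w, hv.insert hx hvy, hx.isLeaf, ?_, ?_⟩
          · rintro rfl; exact hvw hv.adj
          · rw [T.adj_comm, hx.adj_iff v hv.mem]; exact hvy
        · exact ⟨v, u, w, t, hv.insert hx hvy, hw.insert hx hwy, hut, hvw⟩

/-- `v` and `w` are nonadjacent vertices that can be attached to `W`. -/
structure AttachTwo (T : SimpleGraph V) (W : Finset V) (v u w t : V) : Prop where
  left : Attach T W v u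
  right : Attach T W w t
  ne : v ≠ w
  not_adj : ¬ T.Adj v w

theorem AttachTwo.symm (h : AttachTwo T W v u w t) : AttachTwo T W w t v u :=
  ⟨h.right, h.left, h.ne.symm, fun h' => h.not_adj h'.symm⟩

theorem AttachTwo.attach (h : AttachTwo T W v u w t) : Attach T (insert v W) w t where
  mem := Finset.mem_insert_of_mem h.right.mem
  notMem := by simp [h.ne.symm, h.right.notMem]
  adj_iff y hy := by
    rcases Finset.mem_insert.1 hy with rfl | hy
    · have : y ≠ t := by rintro rfl; exact h.left.notMem h.right.mem
      simp [this, T.adj_comm w, h.not_adj]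
    · exact h.right.adj_iff y hy

theorem IsSubtree.attachTwo (hW : IsSubtree T W) (hv : IsLeaf T W v u) (hw : IsLeaf T W w t)
    (hne : v ≠ w) (hvw : ¬ T.Adj v w) :
    IsSubtree T ((W.erase v).erase w) ∧ AttachTwo T ((W.erase v).erase w) v u w t := by
  have hut : u ≠ w := by rintro rfl; exact hvw hv.adj
  have htv : t ≠ v := by rintro rfl; exact hvw hw.adj.symm
  have hw' : IsLeaf T (W.erase v) w t := hw.mono (Finset.erase_subset _ _)
    (Finset.mem_erase.2 ⟨hne.symm, hw.mem⟩) (Finset.mem_erase.2 ⟨htv, hw.mem'⟩)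
  refine ⟨(hW.erase hv).erase hw', ⟨?_, ?_, ?_⟩, hw'.attach, hne, hvw⟩
  · exact Finset.mem_erase.2 ⟨hut, hv.attach.mem⟩
  · exact fun h => hv.attach.notMem (Finset.mem_of_mem_erase h)
  · exact fun y hy => hv.attach.adj_iff y (Finset.mem_of_mem_erase hy)

/-- A star on four vertices or more has two leaves different from `z`. Otherwise there are two
leaves with different neighbours, at most one of them is `z`, and that one is named `v`. So `v = z`
can occur only when `u ≠ t`. -/
theorem IsSubtree.exists_attachTwo (hW : IsSubtree T W) (hc : 4 ≤ W.card) (z : V) :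
    ∃ W₀ v u w t, IsSubtree T W₀ ∧ AttachTwo T W₀ v u w t ∧ W = insert w (insert v W₀) ∧ w ≠ z ∧
      (u ≠ t ∨ (v ≠ z ∧ u = t ∧ ∀ a ∈ W₀, a ≠ u → T.Adj u a)) := by
  have hins : ∀ {v w : V}, v ∈ W → w ∈ W → v ≠ w →
      W = insert w (insert v ((W.erase v).erase w)) := by
    intro v w hv hw hne
    ext a
    simp only [Finset.mem_insert, Finset.mem_erase]
    by_cases h1 : a = w <;> by_cases h2 : a = v <;> simp_all
  rcases hW.star_or_leaves (by omega) with ⟨c, hc', hstar⟩ | ⟨v, u, w, t, hv, hw, hut, hvw⟩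
  · have : 1 < ((W.erase c).erase z).card := by
      have h1 := Finset.card_erase_of_mem hc'
      have h2 := Finset.pred_card_le_card_erase (s := W.erase c) (a := z)
      omega
    obtain ⟨v, hv, w, hw, hne⟩ := Finset.one_lt_card.1 this
    simp only [Finset.mem_erase] at hv hw
    have hlv := hstar v hv.2.2 hv.2.1
    have hlw := hstar w hw.2.2 hw.2.1
    have hvw : ¬ T.Adj v w := by
      rw [hlv.adj_iff w hlw.mem]; exact hw.2.1
    obtain ⟨h1, h2⟩ := hW.attachTwo hlv hlw hne hvw
    refine ⟨_, v, c, w, c, h1, h2, hins hlv.mem hlw.mem hne, hw.1, Or.inr ⟨hv.1, rfl, ?_⟩⟩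
    intro a ha hac
    exact (hstar a (Finset.mem_of_mem_erase (Finset.mem_of_mem_erase ha)) hac).adj.symm
  · have hne : v ≠ w := by
      rintro rfl
      exact hut ((hw.adj_iff u hv.mem').1 hv.adj)
    by_cases hwz : w = z
    · obtain ⟨h1, h2⟩ := hW.attachTwo hw hv hne.symm (fun h => hvw h.symm)
      exact ⟨_, w, t, v, u, h1, h2, hins hw.mem hv.mem hne.symm, hwz ▸ hne, Or.inl hut.symm⟩
    · obtain ⟨h1, h2⟩ := hW.attachTwo hv hw hne hvw
      exact ⟨_, v, u, w, t, h1, h2, hins hv.mem hw.mem hne, hwz, Or.inl hut⟩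

theorem IsSubtree.exists_attach_ne (hW : IsSubtree T W) (hc : 3 ≤ W.card) (z : V) :
    ∃ W₀ v u, IsSubtree T W₀ ∧ Attach T W₀ v u ∧ W = insert v W₀ ∧ v ≠ z := by
  have key : ∃ v u, IsLeaf T W v u ∧ v ≠ z := by
    rcases hW.star_or_leaves (by omega) with ⟨c, hc', hstar⟩ | ⟨v, u, w, t, hv, hw, hut, hvw⟩
    · have : 0 < ((W.erase c).erase z).card := by
        have h1 := Finset.card_erase_of_mem hc'
        have h2 := Finset.pred_card_le_card_erase (s := W.erase c) (a := z)
        omega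
      obtain ⟨v, hv⟩ := Finset.card_pos.1 this
      simp only [Finset.mem_erase] at hv
      exact ⟨v, c, hstar v hv.2.2 hv.2.1, hv.1⟩
    · by_cases hvz : v = z
      · refine ⟨w, t, hw, ?_⟩
        rintro rfl
        subst hvz
        exact hut ((hw.adj_iff u hv.mem').1 hv.adj)
      · exact ⟨v, u, hv, hvz⟩
  obtain ⟨v, u, hv, hvz⟩ := key
  exact ⟨_, v, u, hW.erase hv, hv.attach, (Finset.insert_erase hv.mem).symm, hvz⟩

theorem IsSubtree.exists_walk (hW : IsSubtree T W) :
    ∀ x ∈ W, ∀ y ∈ W, ∃ p : T.Walk x y, ∀ a ∈ p.support, a ∈ W := by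
  induction hW with
  | single r =>
    intro x hx y hy
    rw [Finset.mem_singleton] at hx hy
    subst hx; subst hy
    exact ⟨.nil, by simp⟩
  | @grow W v u hW h ih =>
    have aux : ∀ x ∈ insert v W, ∃ p : T.Walk x u, ∀ a ∈ p.support, a ∈ insert v W := by
      intro x hx
      rcases Finset.mem_insert.1 hx with rfl | hx
      · exact ⟨h.adj.toWalk, by simp [h.mem]⟩
      · obtain ⟨p, hp⟩ := ih x hx u h.mem
        exact ⟨p, fun a ha => Finset.mem_insert_of_mem (hp a ha)⟩
    intro x hx y hy
    obtain ⟨p, hp⟩ := aux x hx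
    obtain ⟨q, hq⟩ := aux y hy
    refine ⟨p.append q.reverse, fun a ha => ?_⟩
    rw [SimpleGraph.Walk.mem_support_append_iff] at ha
    rcases ha with ha | ha
    · exact hp a ha
    · exact hq a (by simpa using ha)

/-- A largest subtree grown leaf by leaf is everything: otherwise connectedness gives an edge
leaving it, and its outer end has no second neighbour inside, since that would give two paths
between the same vertices. -/
theorem isSubtree_univ [Fintype V] (hT : T.IsTree) : IsSubtree T (Finset.univ : Finset V) := by
  classical
  obtain ⟨r⟩ := hT.connected.nonempty
  obtain ⟨W, hW, hmax⟩ := Finset.exists_max_image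
    ((Finset.univ : Finset (Finset V)).filter (IsSubtree T)) Finset.card
    ⟨{r}, by simp [IsSubtree.single]⟩
  simp only [Finset.mem_filter, Finset.mem_univ, true_and] at hW hmax
  by_contra hne
  have hWne : W ≠ Finset.univ := by rintro rfl; exact hne hW
  obtain ⟨b, hb⟩ : ∃ b, b ∉ W := by
    by_contra hall
    push Not at hall
    exact hWne (Finset.eq_univ_iff_forall.2 hall)
  obtain ⟨a, ha⟩ := hW.nonempty
  obtain ⟨p⟩ := hT.connected.preconnected a b
  obtain ⟨d, -, hu, hv⟩ := p.exists_boundary_dart (W : Set V) ha hb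
  obtain ⟨⟨u, v⟩, hd⟩ := d
  simp only [Finset.mem_coe] at hu hv hd
  have hatt : Attach T W v u := by
    refine ⟨hu, hv, fun y hy => ⟨fun hvy => ?_, ?_⟩⟩
    · by_contra hyu
      obtain ⟨q, hq⟩ := hW.exists_walk u hu y hy
      have hq' : v ∉ q.toPath.1.support := fun h =>
        hv (hq v (q.support_toPath_subset_support h))
      let q₁ : T.Path u y := q.toPath
      have hP : (SimpleGraph.Walk.cons hd (SimpleGraph.Walk.cons hvy .nil) : T.Walk u y).IsPath := by
        have huv : u ≠ v := hd.ne
        have hvy' : v ≠ y := hvy.ne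
        simp [SimpleGraph.Walk.cons_isPath_iff, huv, hvy', Ne.symm hyu]
      have := (hT.isAcyclic.subsingleton_path u y).elim q₁ ⟨_, hP⟩
      apply hq'
      change v ∈ q₁.1.support
      rw [this]
      simp
    · rintro rfl; exact hd.symm
  have h1 := hmax _ (hW.grow hatt)
  rw [Finset.card_insert_of_notMem hv] at h1
  omega

/-! ### Proper colourings of a subtree -/

/-- `f` is a proper colouring of the subgraph induced on `W`. -/
def Proper (T : SimpleGraph V) (W : Finset V) (f : V → Fin k) : Prop :=
  ∀ ⦃x⦄, x ∈ W → ∀ ⦃y⦄, y ∈ W → T.Adj x y → f x ≠ f y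

theorem kerInvariant_proper (T : SimpleGraph V) (W : Finset V) :
    KerInvariant W (Proper (k := k) T W) :=
  fun _ _ hfg hf _ hx _ hy hxy h => hf hx hy hxy ((hfg hx hy).2 h)

theorem Attach.proper_insert (h : Attach T W v u) {f : V → Fin k} :
    Proper T (insert v W) f ↔ Proper T W f ∧ f v ≠ f u := by
  constructor
  · intro hf
    exact ⟨fun x hx y hy => hf (Finset.mem_insert_of_mem hx) (Finset.mem_insert_of_mem hy),
      hf (Finset.mem_insert_self _ _) (Finset.mem_insert_of_mem h.mem) h.adj⟩
  · rintro ⟨hf, hvu⟩ x hx y hy hxy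
    rcases Finset.mem_insert.1 hx with rfl | hx' <;> rcases Finset.mem_insert.1 hy with rfl | hy'
    · exact absurd hxy (T.loopless.irrefl _)
    · rw [(h.adj_iff y hy').1 hxy]; exact hvu
    · rw [(h.adj_iff x hx').1 hxy.symm]; exact hvu.symm
    · exact hf hx' hy' hxy

theorem IsSubtree.two_le_card_image (hW : IsSubtree T W) (hc : 2 ≤ W.card) {f : V → Fin k}
    (hf : Proper T W f) : 2 ≤ (W.image f).card := by
  obtain ⟨x, hx⟩ := hW.nonempty
  obtain ⟨y, hy, hxy⟩ := hW.exists_adj hc x hx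
  exact Finset.one_lt_card.2 ⟨f x, Finset.mem_image_of_mem f hx, f y, Finset.mem_image_of_mem f hy,
    hf hx hy hxy⟩

/-- `f` takes at most two values on `W`. -/
def TwoColoured (W : Finset V) (f : V → Fin k) : Prop :=
  ∀ ⦃a⦄, a ∈ W → ∀ ⦃b⦄, b ∈ W → ∀ ⦃c⦄, c ∈ W → f a ≠ f b → f c = f a ∨ f c = f b

/-- A tree has only one bipartition. -/
theorem IsSubtree.sameKer_of_twoColoured (hW : IsSubtree T W) {f g : V → Fin k}
    (hf : Proper T W f) (hg : Proper T W g) (hf2 : TwoColoured W f) (hg2 : TwoColoured W g) :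
    SameKer W f g := by
  induction hW with
  | single r =>
    intro x hx y hy
    rw [Finset.mem_singleton] at hx hy
    subst hx; subst hy; simp
  | @grow W v u hW h ih =>
    rw [h.proper_insert] at hf hg
    have hs := ih hf.1 hg.1
      (fun a ha b hb c hc => hf2 (Finset.mem_insert_of_mem ha) (Finset.mem_insert_of_mem hb)
        (Finset.mem_insert_of_mem hc))
      (fun a ha b hb c hc => hg2 (Finset.mem_insert_of_mem ha) (Finset.mem_insert_of_mem hb)
        (Finset.mem_insert_of_mem hc))
    -- As only two colours occur, `f v = f y` means `f y ≠ f u`, and likewise for `g`; the induction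
    -- hypothesis compares `y` with `u`.
    have key : ∀ y ∈ W, (f v = f y ↔ g v = g y) := by
      intro y hy
      have h1 := hs hy h.mem
      have h2 := hf2 (Finset.mem_insert_self v W) (Finset.mem_insert_of_mem h.mem)
        (Finset.mem_insert_of_mem hy) hf.2
      have h3 := hg2 (Finset.mem_insert_self v W) (Finset.mem_insert_of_mem h.mem)
        (Finset.mem_insert_of_mem hy) hg.2
      have h4 := hf.2
      have h5 := hg.2
      grind
    intro x hx y hy
    rcases Finset.mem_insert.1 hx with rfl | hx' <;> rcases Finset.mem_insert.1 hy with rfl | hy'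
    · simp
    · exact key y hy'
    · rw [eq_comm, key x hx', eq_comm]
    · exact hs hx' hy'

/-! ### Extending a path of four-colourings to a leaf -/

theorem step_update_same (W : Finset V) (v : V) (f : V → Fin k) (c d : Fin k) :
    Step (insert v W) (Function.update f v c) (Function.update f v d) :=
  Step.of_eq (Finset.mem_insert_self v W) fun y _ hy => by simp [hy]

theorem Move.update {f g : V → Fin k} (h : Move W f g) (v : V) (c : Fin k) :
    Move (insert v W) (Function.update f v c) (Function.update g v c) := by
  obtain ⟨x, hx, d, rfl⟩ := h
  by_cases hxv : x = v
  · subst hxv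
    exact ⟨x, by simp, c, by simp⟩
  · exact ⟨x, Finset.mem_insert_of_mem hx, d, by rw [Function.update_comm hxv]⟩

/-- A vertex is not recoloured back immediately. -/
theorem no_return {f g : V → Fin k} {l : List (V → Fin k)} (hch : (f :: g :: l).IsChain (Move W))
    (hpw : (f :: g :: l).Pairwise fun f g => ¬ SameKer W f g) (hgf : g u ≠ f u) :
    ∀ h ∈ l.head?, h u ≠ f u := by
  rintro h hh hhf
  cases l with
  | nil => simp at hh
  | cons h' l =>
    simp only [List.head?_cons, Option.mem_some_iff] at hh
    subst hh
    rw [List.isChain_cons_cons, List.isChain_cons_cons] at hch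
    have e1 := hch.1.eq_update hgf
    have e2 := hch.2.1.eq_update (x := u) (by rw [hhf]; exact hgf.symm)
    have : h' = f := by
      rw [e2, e1, hhf]; simp
    exact (List.pairwise_cons.1 hpw).1 h' (by simp) (this ▸ SameKer.refl W _)

theorem coe_fib_four (v : V) {u : V} {f : V → Fin 4} {p q r : Fin 4} (hpq : p ≠ q) (hpr : p ≠ r)
    (hqr : q ≠ r) (hp : p ≠ f u) (hq : q ≠ f u) (hr : r ≠ f u) :
    (fib v u f : Multiset (V → Fin 4)) =
      {Function.update f v p} + {Function.update f v q} + {Function.update f v r} := by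
  have key : ∀ a p q r : Fin 4, p ≠ q → p ≠ r → q ≠ r → p ≠ a → q ≠ a → r ≠ a →
      ((List.finRange 4).filter (· ≠ a)).Perm [p, q, r] := by decide
  have h := (key (f u) p q r hpq hpr hqr hp hq hr).map (Function.update f v)
  rw [fib, Multiset.coe_eq_coe.2 h]
  rfl

/-- A path of four-colourings extends to a path through all their extensions to a new leaf `v`,
between two extensions of the first colouring. -/
theorem triangle_path (v u : V) (l : List (V → Fin 4)) : ∀ (f : V → Fin 4),
    (f :: l).IsChain (Move W) → (f :: l).Pairwise (fun f g => ¬ SameKer W f g) →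
    ∀ p q, p ≠ q → p ≠ f u → q ≠ f u → (∀ g ∈ l.head?, g u = f u ∨ g u = p ∨ g u = q) →
    HamPath (Step (insert v W)) (Function.update f v p) (Function.update f v q)
      ((f :: l).flatMap (fib v u) : List (V → Fin 4)) := by
  have hthird : ∀ a p q : Fin 4, p ≠ q → p ≠ a → q ≠ a →
      ∃ r, p ≠ r ∧ q ≠ r ∧ r ≠ a := by decide
  have hcover : ∀ a p q r : Fin 4, p ≠ q → p ≠ r → q ≠ r → p ≠ a → q ≠ a → r ≠ a →
      ∀ x, x = a ∨ x = p ∨ x = q ∨ x = r := by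
    omega
  induction l with
  | nil =>
    intro f _ _ p q hpq hp hq _
    obtain ⟨r, hpr, hqr, hr⟩ := hthird (f u) p q hpq hp hq
    refine (((HamPath.single _ _).snoc (step_update_same W v f p r)).snoc
      (step_update_same W v f r q)).congr ?_
    simp only [List.flatMap_cons, List.flatMap_nil, List.append_nil]
    rw [coe_fib_four v hpr hpq hqr.symm hp hr hq]
  | cons g l ih =>
    intro f hch hpw p q hpq hp hq hhead
    obtain ⟨r, hpr, hqr, hr⟩ := hthird (f u) p q hpq hp hq
    have hall := hcover (f u) p q r hpq hpr hqr hp hq hr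
    have hback := no_return (u := u) hch hpw
    rw [List.isChain_cons_cons] at hch
    have hpw' := hpw.of_cons
    have hfg : g u = f u ∨ g u = p ∨ g u = q := hhead g (by simp)
    -- Route by the colour at `v`: `f` with `p`, then all of the rest from `g` with `p` to `g` with
    -- `r`, then `f` with `r` and `f` with `q`.
    have left : p ≠ g u → r ≠ g u → (∀ h ∈ l.head?, h u = g u ∨ h u = p ∨ h u = r) →
        HamPath (Step (insert v W)) (Function.update f v p) (Function.update f v q)
          ((f :: g :: l).flatMap (fib v u) : List (V → Fin 4)) := by
      intro hp' hr' hh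
      refine (((HamPath.cons (hch.1.update v p).step
        (ih g hch.2 hpw' p r hpr hp' hr' hh)).snoc (hch.1.update v r).step.symm).snoc
        (step_update_same W v f r q)).congr ?_
      rw [List.flatMap_cons (x := f), ← Multiset.coe_add, coe_fib_four v hpr hpq hqr.symm hp hr hq]
      abel
    -- The mirror route: `f` with `p`, `f` with `r`, the rest from `r` to `q`, and `f` with `q`.
    have right : r ≠ g u → q ≠ g u → (∀ h ∈ l.head?, h u = g u ∨ h u = r ∨ h u = q) →
        HamPath (Step (insert v W)) (Function.update f v p) (Function.update f v q)
          ((f :: g :: l).flatMap (fib v u) : List (V → Fin 4)) := by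
      intro hr' hq' hh
      refine (HamPath.cons (step_update_same W v f p r) (HamPath.cons (hch.1.update v r).step
        ((ih g hch.2 hpw' r q hqr.symm hr' hq' hh).snoc (hch.1.update v q).step.symm))).congr ?_
      rw [List.flatMap_cons (x := f), ← Multiset.coe_add, coe_fib_four v hpr hpq hqr.symm hp hr hq]
      abel
    -- If `u` keeps its colour, both routes are open and the one compatible with the following
    -- recolouring is taken. If `u` receives `p` or `q`, only one route is open; the one bad colour
    -- for the following recolouring is then `f u`, which `hback` excludes.
    rcases hfg with hgf | hgp | hgq
    · by_cases hx : ∀ h ∈ l.head?, h u ≠ q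
      · refine left (by rw [hgf]; exact hp) (by rw [hgf]; exact hr) fun h hh => ?_
        rw [hgf]
        rcases hall (h u) with e | e | e | e
        · exact Or.inl e
        · exact Or.inr (Or.inl e)
        · exact absurd e (hx h hh)
        · exact Or.inr (Or.inr e)
      · push Not at hx
        obtain ⟨h₀, hh₀, hq₀⟩ := hx
        refine right (by rw [hgf]; exact hr) (by rw [hgf]; exact hq) fun h hh => ?_
        have : h = h₀ := Option.mem_unique hh hh₀
        subst this
        exact Or.inr (Or.inr hq₀)
    · refine right (by rw [hgp]; exact hpr.symm) (by rw [hgp]; exact hpq.symm) fun h hh => ?_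
      rw [hgp]
      rcases hall (h u) with e | e | e | e
      · exact (hback (by rw [hgp]; exact hp) h hh e).elim
      · exact Or.inl e
      · exact Or.inr (Or.inr e)
      · exact Or.inr (Or.inl e)
    · refine left (by rw [hgq]; exact hpq) (by rw [hgq]; exact hqr.symm) fun h hh => ?_
      rw [hgq]
      rcases hall (h u) with e | e | e | e
      · exact (hback (by rw [hgq]; exact hq) h hh e).elim
      · exact Or.inr (Or.inl e)
      · exact Or.inl e
      · exact Or.inr (Or.inr e)

/-! ### Extending a path of three-colourings to two leaves -/

/-- The colouring `f` modified to take the values `c` at `v` and `d` at `w`. -/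
def place (v w : V) (f : V → Fin k) (c d : Fin k) : V → Fin k :=
  Function.update (Function.update f v c) w d

/-- The extensions of `f` to leaves `v` and `w` attached to `u` and `t`. -/
def sq (v u w t : V) (f : V → Fin k) : List (V → Fin k) := (fib v u f).flatMap (fib w t)

theorem place_comm (h : v ≠ w) (f : V → Fin k) (c d : Fin k) : place v w f c d = place w v f d c :=
  Function.update_comm h _ _ _

theorem step_place_right (W : Finset V) (v w : V) (f : V → Fin k) (c d d' : Fin k) :
    Step (insert w (insert v W)) (place v w f c d) (place v w f c d') :=
  step_update_same _ _ _ _ _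

theorem step_place_left (W : Finset V) (h : v ≠ w) (f : V → Fin k) (c c' d : Fin k) :
    Step (insert w (insert v W)) (place v w f c d) (place v w f c' d) := by
  rw [Finset.insert_comm, place_comm h, place_comm h]
  exact step_place_right W w v f d c c'

theorem Move.place {f g : V → Fin k} (h : Move W f g) (v w : V) (c d : Fin k) :
    Step (insert w (insert v W)) (place v w f c d) (place v w g c d) :=
  ((h.update v c).update w d).step

theorem coe_fib_three (v : V) {u : V} {f : V → Fin 3} {p q : Fin 3} (hpq : p ≠ q)
    (hp : p ≠ f u) (hq : q ≠ f u) :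
    (fib v u f : Multiset (V → Fin 3)) = {Function.update f v p} + {Function.update f v q} := by
  have key : ∀ a p q : Fin 3, p ≠ q → p ≠ a → q ≠ a →
      ((List.finRange 3).filter (· ≠ a)).Perm [p, q] := by decide
  have h := (key (f u) p q hpq hp hq).map (Function.update f v)
  rw [fib, Multiset.coe_eq_coe.2 h]
  rfl

theorem coe_sq {f : V → Fin 3} {c c' d d' : Fin 3} (htv : t ≠ v) (hc : c ≠ c') (hd : d ≠ d')
    (hcu : c ≠ f u) (hcu' : c' ≠ f u) (hdt : d ≠ f t) (hdt' : d' ≠ f t) :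
    (sq v u w t f : Multiset (V → Fin 3)) =
      {place v w f c d} + {place v w f c d'} + {place v w f c' d} + {place v w f c' d'} := by
  rw [sq, ← Multiset.coe_bind, coe_fib_three v hc hcu hcu', Multiset.add_bind,
    Multiset.singleton_bind, Multiset.singleton_bind]
  rw [coe_fib_three w hd (by simpa [htv] using hdt) (by simpa [htv] using hdt'),
    coe_fib_three w hd (by simpa [htv] using hdt) (by simpa [htv] using hdt')]
  simp only [place]
  abel

theorem exists_fin_three : ∀ a b : Fin 3, a ≠ b → ∃ c, c ≠ a ∧ c ≠ b := by decide

theorem fin_three_cases : ∀ a b c : Fin 3, a ≠ b → c ≠ a → c ≠ b → ∀ x, x = a ∨ x = b ∨ x = c := by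
  omega

theorem coe_sq_comm (h : AttachTwo T W v u w t) (f : V → Fin 3) :
    (sq v u w t f : Multiset (V → Fin 3)) = sq w t v u f := by
  have htv : t ≠ v := by rintro rfl; exact h.left.notMem h.right.mem
  have huw : u ≠ w := by rintro rfl; exact h.right.notMem h.left.mem
  have key : ∀ a : Fin 3, ∃ c c', c ≠ c' ∧ c ≠ a ∧ c' ≠ a := by decide
  obtain ⟨c, c', hc, hcu, hcu'⟩ := key (f u)
  obtain ⟨d, d', hd, hdt, hdt'⟩ := key (f t)
  rw [coe_sq htv hc hd hcu hcu' hdt hdt', coe_sq huw hd hc hdt hdt' hcu hcu']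
  simp only [place_comm h.ne]
  abel

theorem coe_flatMap_sq_comm (h : AttachTwo T W v u w t) (l : List (V → Fin 3)) :
    (l.flatMap (sq v u w t) : Multiset (V → Fin 3)) = l.flatMap (sq w t v u) := by
  induction l with
  | nil => rfl
  | cons f l ih =>
    rw [List.flatMap_cons, List.flatMap_cons, ← Multiset.coe_add, ← Multiset.coe_add, ih,
      coe_sq_comm h]

/-- There are paths through all extensions of the colourings in `l` between the extensions of `f`
which give `w` the colour `d`. -/
def EdgePath (W : Finset V) (v u w t : V) (f : V → Fin 3) (l : List (V → Fin 3)) (d : Fin 3) :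
    Prop :=
  ∀ c c', c ≠ c' → c ≠ f u → c' ≠ f u →
    HamPath (Step (insert w (insert v W))) (place v w f c d) (place v w f c' d)
      (l.flatMap (sq v u w t) : List (V → Fin 3))

theorem EdgePath.swap (h : AttachTwo T W v u w t) {f : V → Fin 3} {l : List (V → Fin 3)}
    {c d d' : Fin 3} (he : EdgePath W w t v u f l c) (hd : d ≠ d') (hdt : d ≠ f t)
    (hdt' : d' ≠ f t) :
    HamPath (Step (insert w (insert v W))) (place v w f c d) (place v w f c d')
      (l.flatMap (sq v u w t) : List (V → Fin 3)) := by
  rw [Finset.insert_comm, place_comm h.ne, place_comm h.ne, coe_flatMap_sq_comm h]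
  exact he d d' hd hdt hdt'

/-- With pairs denoting the colours of `v` and `w`, the route is `f (c, d)`, the rest from `g (c,
d)` to `g (c, d')`, then `f (c, d')`, `f (c', d')`, `f (c', d)`. Only the colour `c` has to be legal
at `v` in `g`, so `u` may be recoloured to `c'`. -/
theorem edgePath_detour_right (h : AttachTwo T W v u w t) {f g : V → Fin 3}
    {l : List (V → Fin 3)} (hfg : Move W f g) {c c' d : Fin 3} (hc : c ≠ c') (hcu : c ≠ f u)
    (hcu' : c' ≠ f u) (hdt : d ≠ f t) (hgt : g t = f t)
    (he : EdgePath W w t v u g l c) :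
    HamPath (Step (insert w (insert v W))) (place v w f c d) (place v w f c' d)
      (sq v u w t f + l.flatMap (sq v u w t) : Multiset (V → Fin 3)) := by
  have htv : t ≠ v := by rintro rfl; exact h.left.notMem h.right.mem
  obtain ⟨d', hd', hdt'⟩ := exists_fin_three d (f t) hdt
  refine ((((HamPath.cons (hfg.place v w c d)
    (he.swap h hd'.symm (by rw [hgt]; exact hdt) (by rw [hgt]; exact hdt'))).snoc
    (hfg.place v w c d').symm).snoc (step_place_left W h.ne f c c' d')).snoc
    (step_place_right W v w f c' d' d)).congr ?_
  rw [coe_sq htv hc hd'.symm hcu hcu' hdt hdt']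
  abel

/-- The route leaves through the opposite edge: `f (c, d)`, `f (c, d')`, the rest from `g (c, d')`
to `g (c', d')`, then `f (c', d')`, `f (c', d)`. This serves when `t` is recoloured to `d`. -/
theorem edgePath_detour_left (h : AttachTwo T W v u w t) {f g : V → Fin 3}
    {l : List (V → Fin 3)} (hfg : Move W f g) {c c' d d' : Fin 3} (hc : c ≠ c') (hcu : c ≠ f u)
    (hcu' : c' ≠ f u) (hd : d ≠ d') (hdt : d ≠ f t) (hdt' : d' ≠ f t) (hgu : g u = f u)
    (he : EdgePath W v u w t g l d') :
    HamPath (Step (insert w (insert v W))) (place v w f c d) (place v w f c' d)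
      (sq v u w t f + l.flatMap (sq v u w t) : Multiset (V → Fin 3)) := by
  have htv : t ≠ v := by rintro rfl; exact h.left.notMem h.right.mem
  refine (HamPath.cons (step_place_right W v w f c d d') (((HamPath.cons (hfg.place v w c d')
    (he c c' hc (by rw [hgu]; exact hcu) (by rw [hgu]; exact hcu'))).snoc
    (hfg.place v w c' d').symm).snoc (step_place_right W v w f c' d' d))).congr ?_
  rw [coe_sq htv hc hd hcu hcu' hdt hdt']
  abel

/-- At most one of `u` and `t` changes from `f` to `g`; this is where `hut` enters. If `t` changes,
the opposite edge is used. If `u` changes, the side edge with the colour of `v` still legal is used.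
In both cases `no_return` supplies the condition on the next colouring. If neither changes, the side
edge is picked by looking one step ahead. -/
theorem edgePath_cons (h : AttachTwo T W v u w t) {f g : V → Fin 3} {l : List (V → Fin 3)}
    (hch : (f :: g :: l).IsChain (Move W))
    (hpw : (f :: g :: l).Pairwise fun f g => ¬ SameKer W f g)
    (hut : g u ≠ f u → u ≠ t)
    (ihv : ∀ d, d ≠ g t → (∀ h ∈ l.head?, h t = g t ∨ h t = d) → EdgePath W v u w t g (g :: l) d)
    (ihw : ∀ c, c ≠ g u → (∀ h ∈ l.head?, h u = g u ∨ h u = c) → EdgePath W w t v u g (g :: l) c)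
    {d : Fin 3} (hdt : d ≠ f t) (hd : g t = f t ∨ g t = d) :
    EdgePath W v u w t f (f :: g :: l) d := by
  have hbu := no_return (u := u) hch hpw
  have hbt := no_return (u := t) hch hpw
  have hfg := (List.isChain_cons_cons.1 hch).1
  intro c c' hc hcu hcu'
  rw [List.flatMap_cons (x := f), ← Multiset.coe_add]
  have hcov := fin_three_cases (f u) c c' hcu.symm hcu' hc.symm
  have swap : HamPath (Step (insert w (insert v W))) (place v w f c' d) (place v w f c d)
      (sq v u w t f + (g :: l).flatMap (sq v u w t) : Multiset (V → Fin 3)) →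
      HamPath (Step (insert w (insert v W))) (place v w f c d) (place v w f c' d)
      (sq v u w t f + (g :: l).flatMap (sq v u w t) : Multiset (V → Fin 3)) :=
    HamPath.symm fun _ _ h => h.symm
  by_cases hgu : g u = f u
  · by_cases hgt : g t = f t
    · by_cases hx : ∀ h ∈ l.head?, h u ≠ c'
      · refine edgePath_detour_right h hfg hc hcu hcu' hdt hgt
          (ihw c (by rw [hgu]; exact hcu) fun h' hh => ?_)
        rw [hgu]
        rcases hcov (h' u) with e | e | e
        · exact Or.inl e
        · exact Or.inr e
        · exact absurd e (hx h' hh)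
      · push Not at hx
        obtain ⟨h₀, hh₀, hq₀⟩ := hx
        refine swap (edgePath_detour_right h hfg hc.symm hcu' hcu hdt hgt
          (ihw c' (by rw [hgu]; exact hcu') fun h' hh => ?_))
        have : h' = h₀ := Option.mem_unique hh hh₀
        subst this
        exact Or.inr hq₀
    · have hgd : g t = d := hd.resolve_left hgt
      obtain ⟨d', hd', hdt'⟩ := exists_fin_three d (f t) hdt
      refine edgePath_detour_left h hfg hc hcu hcu' hd'.symm hdt hdt' hgu
        (ihv d' (by rw [hgd]; exact hd') fun h' hh => ?_)
      rw [hgd]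
      rcases fin_three_cases (f t) d d' hdt.symm hdt' hd' (h' t) with e | e | e
      · exact (hbt hgt h' hh e).elim
      · exact Or.inl e
      · exact Or.inr e
  · have hgt : g t = f t := hfg.eq_of_ne hgu (hut hgu).symm
    have hgc : g u = c ∨ g u = c' := (hcov (g u)).resolve_left hgu
    rcases hgc with hgc | hgc
    · refine swap (edgePath_detour_right h hfg hc.symm hcu' hcu hdt hgt
        (ihw c' (by rw [hgc]; exact hc.symm) fun h' hh => ?_))
      rw [hgc]
      exact (hcov (h' u)).resolve_left (hbu hgu h' hh)
    · refine edgePath_detour_right h hfg hc hcu hcu' hdt hgt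
        (ihw c (by rw [hgc]; exact hc) fun h' hh => ?_)
      rw [hgc]
      exact ((hcov (h' u)).resolve_left (hbu hgu h' hh)).symm

theorem edgePath_single (h : AttachTwo T W v u w t) {f : V → Fin 3} {d : Fin 3} (hdt : d ≠ f t) :
    EdgePath W v u w t f [f] d := by
  intro c c' hc hcu hcu'
  have htv : t ≠ v := by rintro rfl; exact h.left.notMem h.right.mem
  obtain ⟨d', hd', hdt'⟩ := exists_fin_three d (f t) hdt
  refine ((((HamPath.single _ _).snoc (step_place_right W v w f c d d')).snoc
    (step_place_left W h.ne f c c' d')).snoc (step_place_right W v w f c' d' d)).congr ?_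
  rw [List.flatMap_cons, List.flatMap_nil, List.append_nil,
    coe_sq htv hc hd'.symm hcu hcu' hdt hdt']
  abel

/-- A path of three-colourings extends to a path through all their extensions to two new leaves,
between any two adjacent extensions of the first colouring which are compatible with the
recolouring that follows. -/
theorem edgePath (l : List (V → Fin 3)) : ∀ (f : V → Fin 3), (f :: l).IsChain (Move W) →
    (f :: l).Pairwise (fun f g => ¬ SameKer W f g) → ∀ v u w t, AttachTwo T W v u w t →
    (u = t → (f :: l).IsChain fun f g => g u = f u) →
    ∀ d, d ≠ f t → (∀ g ∈ l.head?, g t = f t ∨ g t = d) → EdgePath W v u w t f (f :: l) d := by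
  induction l with
  | nil => exact fun f _ _ v u w t h _ d hd _ => edgePath_single h hd
  | cons g l ih =>
    intro f hch hpw v u w t h hut d hd hg
    have hch' := (List.isChain_cons_cons.1 hch).2
    refine edgePath_cons h hch hpw (fun hgu hut' => ?_) ?_ ?_ hd (hg g (by simp))
    · exact hgu (List.isChain_cons_cons.1 (hut hut')).1
    · exact ih g hch' hpw.of_cons v u w t h fun e => (List.isChain_cons_cons.1 (hut e)).2
    · refine ih g hch' hpw.of_cons w t v u h.symm fun e => ?_
      subst e
      exact (List.isChain_cons_cons.1 (hut rfl)).2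

/-! ### Three-colourings of a tree -/

theorem Enumerates.congr {p q : (V → Fin k) → Prop} {L : List (V → Fin k)}
    (hL : Enumerates W p L) (h : ∀ f, p f ↔ q f) : Enumerates W q L := by
  rwa [show q = p from funext fun f => propext (h f).symm]

theorem IsSubtree.enumerates_fib (hW : IsSubtree T W) (hc : 2 ≤ W.card) (h : Attach T W v u)
    {L : List (V → Fin 3)} (hL : Enumerates W (Proper T W) L) :
    Enumerates (insert v W) (Proper T (insert v W)) (L.flatMap (fib v u)) := by
  refine (hL.flatMap_fib (kerInvariant_proper T W) h.notMem h.mem fun f hf => ?_).congr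
    fun f => h.proper_insert.symm
  have := hW.two_le_card_image hc hf
  omega

theorem IsSubtree.enumerates_sq (hW : IsSubtree T W) (hc : 2 ≤ W.card)
    (h : AttachTwo T W v u w t) {L : List (V → Fin 3)} (hL : Enumerates W (Proper T W) L) :
    Enumerates (insert w (insert v W)) (Proper T (insert w (insert v W)))
      (L.flatMap (sq v u w t)) := by
  have hc' : 2 ≤ (insert v W).card := by
    rw [Finset.card_insert_of_notMem h.left.notMem]; omega
  have := (hW.grow h.left).enumerates_fib hc' h.attach (hW.enumerates_fib hc h.left hL)
  rwa [List.flatMap_assoc] at this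

/-- `b` is the bipartition of the tree, `b :: l` lists all three-colourings, and `l` is a path whose
ends are obtained from `b` by separating `x` and `y` from their cells. -/
structure BellPath (T : SimpleGraph V) (W : Finset V) (b : V → Fin 3) (l : List (V → Fin 3))
    (x y : V) : Prop where
  mem_left : x ∈ W
  mem_right : y ∈ W
  ne_two : ∀ a ∈ W, b a ≠ 2
  enum : Enumerates W (Proper T W) (b :: l)
  chain : l.IsChain (Step W)
  head : ∃ p ∈ l.head?, SameKer W p (Function.update b x 2)
  last : ∃ q ∈ l.getLast?, SameKer W q (Function.update b y 2)

namespace BellPath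

variable {b : V → Fin 3} {l : List (V → Fin 3)} {x y : V}

theorem symm (h : BellPath T W b l x y) : BellPath T W b l.reverse y x where
  mem_left := h.mem_right
  mem_right := h.mem_left
  ne_two := h.ne_two
  enum := h.enum.perm ((List.reverse_perm l).symm.cons b)
  chain := by
    rw [List.isChain_reverse]
    exact h.chain.imp fun _ _ h => h.symm
  head := by simpa using h.last
  last := by simpa using h.head

/-- Fixing the colours so that the path starts exactly at `Function.update b x 2` makes `b` followed
by the path a sequence of recolourings, so `no_return` applies from `b` on. -/
theorem normalize (h : BellPath T W b l x y) :
    ∃ l', BellPath T W b (Function.update b x 2 :: l') x y ∧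
      (b :: Function.update b x 2 :: l').IsChain (Move W) ∧ l'.length + 1 = l.length := by
  obtain ⟨p, hp, hpx⟩ := h.head
  cases l with
  | nil => simp at hp
  | cons p' l =>
    simp only [List.head?_cons, Option.mem_some_iff] at hp
    subst hp
    obtain ⟨l', hl', hll⟩ := exists_moves p' _ l h.chain hpx
    have hF : List.Forall₂ (SameKer W) (p' :: l) (Function.update b x 2 :: l') :=
      List.Forall₂.cons hpx hll
    refine ⟨l', ⟨h.mem_left, h.mem_right, h.ne_two, ?_, hl'.imp fun _ _ h => h.step, ?_, ?_⟩,
      ?_, ?_⟩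
    · exact h.enum.forall₂ (kerInvariant_proper T W) (List.Forall₂.cons (SameKer.refl W b) hF)
    · exact ⟨_, rfl, SameKer.refl _ _⟩
    · obtain ⟨q, hq, hqy⟩ := h.last
      have hF' := List.rel_reverse hF
      rw [← List.head?_reverse] at hq ⊢
      revert hF' hq
      generalize (p' :: l).reverse = m
      generalize (Function.update b x 2 :: l').reverse = m'
      intro hq hF'
      cases hF' with
      | nil => simp at hq
      | cons hab _ =>
        simp only [List.head?_cons, Option.mem_some_iff] at hq
        subst hq
        exact ⟨_, rfl, hab.symm.trans hqy⟩
    · rw [List.isChain_cons_cons]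
      exact ⟨⟨x, h.mem_left, 2, rfl⟩, hl'⟩
    · have := hll.length_eq
      simp [this]

theorem of_hamPath {M : Multiset (V → Fin 3)} {L : List (V → Fin 3)} {p q : V → Fin 3}
    (hx : x ∈ W) (hy : y ∈ W) (hb : ∀ a ∈ W, b a ≠ 2) (hL : Enumerates W (Proper T W) L)
    (hM : HamPath (Step W) p q M) (hbM : {b} + M = L)
    (hp : SameKer W p (Function.update b x 2)) (hq : SameKer W q (Function.update b y 2)) :
    ∃ l, BellPath T W b l x y ∧ l.length = M.card := by
  obtain ⟨l, hl, hpl, hql, rfl⟩ := hM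
  refine ⟨l, ⟨hx, hy, hb, hL.perm ?_, hl, ⟨p, by simp [hpl], hp⟩, ⟨q, by simp [hql], hq⟩⟩, by simp⟩
  rw [← Multiset.coe_eq_coe, ← hbM]
  rfl

end BellPath

/-! ### Growing the three-colour path by two leaves -/

section Extend

variable {b f : V → Fin 3} {l : List (V → Fin 3)} {x y : V} {c d : Fin 3}

theorem update_place_right (v w : V) (f : V → Fin k) (c d e : Fin k) :
    Function.update (place v w f c d) w e = place v w f c e := by
  simp [place]

theorem update_place_left (h : v ≠ w) (f : V → Fin k) (c d e : Fin k) :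
    Function.update (place v w f c d) v e = place v w f e d := by
  rw [place_comm h, place_comm h, update_place_right]

theorem AttachTwo.update_place (h : AttachTwo T W v u w t) (hx : x ∈ W) (f : V → Fin k)
    (c d e : Fin k) :
    Function.update (place v w f c d) x e = place v w (Function.update f x e) c d := by
  have hxv : x ≠ v := by rintro rfl; exact h.left.notMem hx
  have hxw : x ≠ w := by rintro rfl; exact h.right.notMem hx
  rw [place, place, Function.update_comm hxw.symm, Function.update_comm hxv.symm]

theorem place_ne_two (hb : ∀ a ∈ W, b a ≠ 2) (hc : c ≠ 2) (hd : d ≠ 2) :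
    ∀ a ∈ insert w (insert v W), place v w b c d a ≠ 2 := by
  intro a ha
  by_cases haw : a = w
  · subst haw; simpa [place] using hd
  · by_cases hav : a = v
    · subst hav; simpa [place, haw] using hc
    · have : a ∈ W := by simpa [haw, hav] using ha
      simpa [place, haw, hav] using hb a this

/-- Joining the extensions of `b` to those of the rest along an edge which keeps `w` fixed. -/
theorem bellPath_side (hW : IsSubtree T W) (hcard : 2 ≤ W.card) (h : AttachTwo T W v u w t)
    (hb : ∀ a ∈ W, b a ≠ 2) (hx : x ∈ W) (hxu : x ≠ u)
    (henum : Enumerates W (Proper T W) (b :: Function.update b x 2 :: l))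
    (hc : c ≠ b u) (hc2 : c ≠ 2) (hd : d ≠ b t) (hd2 : d ≠ 2)
    (he : EdgePath W v u w t (Function.update b x 2) (Function.update b x 2 :: l) d) :
    ∃ l', BellPath T (insert w (insert v W)) (place v w b c d) l' x w ∧ 2 ≤ l'.length := by
  have htv : t ≠ v := by rintro rfl; exact h.left.notMem h.right.mem
  have hbu := hb u h.left.mem
  have hbt := hb t h.right.mem
  have hfu : Function.update b x 2 u = b u := Function.update_of_ne hxu.symm _ _
  have hm : Move W b (Function.update b x 2) := ⟨x, hx, 2, rfl⟩
  -- The square of `b` loses its corner `(c, d)`, the new bipartition. Its other corners are visited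
  -- last, in the order `(2, d)`, `(2, 2)`, `(c, 2)`, and the final one isolates `w`.
  have path := (((he c 2 hc2 (by rw [hfu]; exact hc) (by rw [hfu]; exact hbu.symm)).snoc
    (hm.place v w 2 d).symm).snoc (step_place_right W v w b 2 d 2)).snoc
    (step_place_left W h.ne b 2 c 2)
  obtain ⟨l', hl', hlen⟩ := BellPath.of_hamPath (b := place v w b c d) (x := x) (y := w) (T := T)
    (by simp [hx]) (by simp) (place_ne_two hb hc2 hd2) (hW.enumerates_sq hcard h henum) path
    (by
      simp only [List.flatMap_cons, ← Multiset.coe_add]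
      rw [coe_sq (f := b) htv hc2 hd2 hc hbu.symm hd hbt.symm]
      abel)
    (by rw [h.update_place hx]; exact SameKer.refl _ _)
    (by rw [update_place_right]; exact SameKer.refl _ _)
  refine ⟨l', hl', ?_⟩
  rw [hlen]
  simp

/-- The remaining corners `(2, d)`, `(2, 2)`, `(c, 2)` of the square of `b` form a path of two
edges; either edge can be replaced by a detour through all extensions of `l`. The ends isolate `v`
and `w` respectively. -/
theorem corner_path (h : AttachTwo T W v u w t) (hm : Move W b f) (hfu : f u = b u)
    (hft : f t = b t) (hc : c ≠ b u) (hc2 : c ≠ 2) (hd : d ≠ b t) (hd2 : d ≠ 2)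
    (hbu : b u ≠ 2) (hbt : b t ≠ 2)
    (he : EdgePath W v u w t f l 2 ∨ EdgePath W w t v u f l 2) :
    HamPath (Step (insert w (insert v W))) (place v w b 2 d) (place v w b c 2)
      ({place v w b 2 d} + {place v w b 2 2} + {place v w b c 2} +
        (l.flatMap (sq v u w t) : List (V → Fin 3))) := by
  rcases he with he | he
  · refine (HamPath.cons (step_place_right W v w b 2 d 2) (HamPath.cons (hm.place v w 2 2)
      ((he 2 c hc2.symm (by rw [hfu]; exact hbu.symm) (by rw [hfu]; exact hc)).snoc
      (hm.place v w c 2).symm))).congr ?_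
    abel
  · refine (((HamPath.cons (hm.place v w 2 d)
      (he.swap h hd2 (by rw [hft]; exact hd) (by rw [hft]; exact hbt.symm))).snoc
      (hm.place v w 2 2).symm).snoc (step_place_left W h.ne b 2 c 2)).congr ?_
    abel

/-- The first edge fails only if the next move recolours `t`. Then `u` does not move, and the second
edge works. -/
theorem corner_edge (h : AttachTwo T W v u w t) (hch : (f :: l).IsChain (Move W))
    (hpw : (f :: l).Pairwise fun f g => ¬ SameKer W f g)
    (hut : u = t → (f :: l).IsChain fun f g => g u = f u) (hfu : f u ≠ 2) (hft : f t ≠ 2) :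
    EdgePath W v u w t f (f :: l) 2 ∨ EdgePath W w t v u f (f :: l) 2 := by
  by_cases hx : ∀ g ∈ l.head?, g t = f t ∨ g t = 2
  · exact Or.inl (edgePath l f hch hpw v u w t h hut 2 hft.symm hx)
  · right
    refine edgePath l f hch hpw w t v u h.symm (by rintro rfl; exact hut rfl) 2 hfu.symm ?_
    intro g hg
    push Not at hx
    obtain ⟨g', hg', hgt, -⟩ := hx
    obtain rfl := Option.mem_unique hg hg'
    cases l with
    | nil => simp at hg
    | cons a l =>
      simp only [List.head?_cons, Option.mem_some_iff] at hg
      subst hg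
      by_cases e : u = t
      · subst e
        exact absurd (List.isChain_cons_cons.1 (hut rfl)).1 hgt
      · exact Or.inl ((List.isChain_cons_cons.1 hch).1.eq_of_ne hgt e)

/-- Joining the extensions of `b` to those of the rest along an edge which avoids the bipartition. -/
theorem bellPath_corner (hW : IsSubtree T W) (hcard : 2 ≤ W.card) (h : AttachTwo T W v u w t)
    (hb : ∀ a ∈ W, b a ≠ 2) (hx : x ∈ W) (hxu : x ≠ u) (hxt : x ≠ t)
    (henum : Enumerates W (Proper T W) (b :: Function.update b x 2 :: l))
    (hc : c ≠ b u) (hc2 : c ≠ 2) (hd : d ≠ b t) (hd2 : d ≠ 2)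
    (he : EdgePath W v u w t (Function.update b x 2) (Function.update b x 2 :: l) 2 ∨
      EdgePath W w t v u (Function.update b x 2) (Function.update b x 2 :: l) 2) :
    ∃ l', BellPath T (insert w (insert v W)) (place v w b c d) l' v w ∧ 2 ≤ l'.length := by
  have htv : t ≠ v := by rintro rfl; exact h.left.notMem h.right.mem
  have hbu := hb u h.left.mem
  have hbt := hb t h.right.mem
  have hm : Move W b (Function.update b x 2) := ⟨x, hx, 2, rfl⟩
  have path := corner_path h hm (Function.update_of_ne hxu.symm _ _)
    (Function.update_of_ne hxt.symm _ _) hc hc2 hd hd2 hbu hbt he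
  obtain ⟨l', hl', hlen⟩ := BellPath.of_hamPath (b := place v w b c d) (x := v) (y := w) (T := T)
    (by simp) (by simp) (place_ne_two hb hc2 hd2) (hW.enumerates_sq hcard h henum) path
    (by
      rw [List.flatMap_cons (x := b), ← Multiset.coe_add,
        coe_sq htv hc2 hd2 hc hbu.symm hd hbt.symm]
      abel)
    (by rw [update_place_left h.ne]; exact SameKer.refl _ _)
    (by rw [update_place_right]; exact SameKer.refl _ _)
  refine ⟨l', hl', ?_⟩
  rw [hlen]
  simp only [Multiset.card_add, Multiset.card_singleton]
  omega

/-- As `bellPath_corner`, but the extensions of one neighbour of `b` are joined separately. -/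
theorem bellPath_pendant (hW : IsSubtree T W) (hcard : 2 ≤ W.card) (h : AttachTwo T W v u w t)
    (hb : ∀ a ∈ W, b a ≠ 2) (hx : x ∈ W) (hxu : x ≠ u) (hxt : x ≠ t)
    (hy : y ∈ W) (hyu : y ≠ u) (hyt : y ≠ t)
    (henum : Enumerates W (Proper T W)
      (Function.update b x 2 :: b :: Function.update b y 2 :: l))
    (hc : c ≠ b u) (hc2 : c ≠ 2) (hd : d ≠ b t) (hd2 : d ≠ 2)
    (he : EdgePath W v u w t (Function.update b y 2) (Function.update b y 2 :: l) 2 ∨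
      EdgePath W w t v u (Function.update b y 2) (Function.update b y 2 :: l) 2) :
    ∃ l', BellPath T (insert w (insert v W)) (place v w b c d) l' x w ∧ 2 ≤ l'.length := by
  have htv : t ≠ v := by rintro rfl; exact h.left.notMem h.right.mem
  have hbu := hb u h.left.mem
  have hbt := hb t h.right.mem
  have hm : Move W b (Function.update b y 2) := ⟨y, hy, 2, rfl⟩
  have hmx : Move W b (Function.update b x 2) := ⟨x, hx, 2, rfl⟩
  have hfu : Function.update b x 2 u = b u := Function.update_of_ne hxu.symm _ _
  have hft : Function.update b x 2 t = b t := Function.update_of_ne hxt.symm _ _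
  have corner := corner_path h hm (Function.update_of_ne hyu.symm _ _)
    (Function.update_of_ne hyt.symm _ _) hc hc2 hd hd2 hbu hbt he
  -- The square of the colouring isolating `x` is traversed alone from `(c, d)` to `(2, d)`, and is
  -- joined to the corner path at `b (2, d)`.
  have path := (edgePath_single h (f := Function.update b x 2) (d := d) (by rw [hft]; exact hd)
    c 2 hc2 (by rw [hfu]; exact hc) (by rw [hfu]; exact hbu.symm)).append
    (hmx.place v w 2 d).symm corner
  obtain ⟨l', hl', hlen⟩ := BellPath.of_hamPath (b := place v w b c d) (x := x) (y := w) (T := T)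
    (by simp [hx]) (by simp) (place_ne_two hb hc2 hd2) (hW.enumerates_sq hcard h henum) path
    (by
      simp only [List.flatMap_cons, List.flatMap_nil, List.append_nil, ← Multiset.coe_add]
      rw [coe_sq (f := b) htv hc2 hd2 hc hbu.symm hd hbt.symm]
      abel)
    (by rw [h.update_place hx]; exact SameKer.refl _ _)
    (by rw [update_place_right]; exact SameKer.refl _ _)
  refine ⟨l', hl', ?_⟩
  rw [hlen]
  simp only [Multiset.card_add, Multiset.card_singleton]
  omega

end Extend

/-- The centre of a star is always alone in its cell, so recolouring it would not change the
partition. -/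
theorem chain_centre_const (hstar : ∀ a ∈ W, a ≠ u → T.Adj u a) (hu : u ∈ W)
    (L : List (V → Fin k)) (hL : ∀ f ∈ L, Proper T W f) (hch : L.IsChain (Move W))
    (hpw : L.Pairwise fun f g => ¬ SameKer W f g) : L.IsChain fun f g => g u = f u := by
  induction L with
  | nil => simp
  | cons f L ih =>
    cases L with
    | nil => simp
    | cons g L =>
      rw [List.isChain_cons_cons] at hch ⊢
      refine ⟨?_, ih (fun f hf => hL f (List.mem_cons_of_mem _ hf)) hch.2 hpw.of_cons⟩
      by_contra hgu
      refine (List.pairwise_cons.1 hpw).1 g (by simp) fun x hx y hy => ?_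
      have hf := hL f (by simp)
      have hg := hL g (by simp)
      by_cases hxu : x = u <;> by_cases hyu : y = u
      · subst hxu; subst hyu; simp
      · subst hxu
        have h1 := hf hu hy (hstar y hy hyu)
        have h2 := hg hu hy (hstar y hy hyu)
        simp [h1, h2]
      · subst hyu
        have h1 := hf hx hu (hstar x hx hxu).symm
        have h2 := hg hx hu (hstar x hx hxu).symm
        simp [h1, h2]
      · rw [hch.1.eq_of_ne hgu hxu, hch.1.eq_of_ne hgu hyu]

/-! ### Base cases and induction for the three-colour path -/

theorem IsSubtree.enumerates_edge (hW : IsSubtree T W) (hc : W.card = 2) :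
    ∃ b : V → Fin 3, (∀ a, b a ≠ 2) ∧ Enumerates W (Proper T W) [b] := by
  obtain ⟨x, hx⟩ := hW.nonempty
  obtain ⟨y, hy, hxy⟩ := hW.exists_adj hc.ge x hx
  have hWxy : W = {x, y} := by
    refine (Finset.eq_of_subset_of_card_le ?_ ?_).symm
    · intro a ha
      rcases Finset.mem_insert.1 ha with rfl | ha
      · exact hx
      · rw [Finset.mem_singleton.1 ha]; exact hy
    · rw [hc, Finset.card_pair hxy.ne]
  subst hWxy
  have hne := hxy.ne
  have hne' := hxy.ne'
  have hb : Proper T {x, y} (fun a => if a = x then (0 : Fin 3) else 1) := by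
    intro a ha a' ha' h
    simp only [Finset.mem_insert, Finset.mem_singleton] at ha ha'
    rcases ha with rfl | rfl <;> rcases ha' with rfl | rfl <;> simp_all
  refine ⟨fun a => if a = x then 0 else 1, fun a => ?_, ⟨by simpa using hb, by simp, ?_⟩⟩
  · dsimp only
    split_ifs <;> decide
  · intro g hg
    refine ⟨_, List.mem_singleton_self _, ?_⟩
    have hgxy := hg hx hy hxy
    intro a ha a' ha'
    simp only [Finset.mem_insert, Finset.mem_singleton] at ha ha'
    rcases ha with rfl | rfl <;> rcases ha' with rfl | rfl <;>
      simp_all [Ne.symm hgxy]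

theorem bellPath_card_three (hW : IsSubtree T W) (hc : W.card = 2) (h : Attach T W v u) :
    ∃ b l, BellPath T (insert v W) b l v v := by
  obtain ⟨b, hb, henum⟩ := hW.enumerates_edge hc
  obtain ⟨c, hcu, hc2⟩ := exists_fin_three (b u) 2 (hb u)
  have henum' := hW.enumerates_fib hc.ge h henum
  have hp : (fib v u b).Perm [Function.update b v c, Function.update b v 2] :=
    Multiset.coe_eq_coe.1 (coe_fib_three v hc2 hcu (hb u).symm)
  refine ⟨Function.update b v c, [Function.update b v 2], by simp, by simp, ?_, ?_, by simp,
    ⟨_, rfl, ?_⟩, ⟨_, rfl, ?_⟩⟩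
  · intro a _
    by_cases hav : a = v
    · subst hav; simpa using hc2
    · simpa [hav] using hb a
  · exact henum'.perm (by simpa using hp)
  all_goals
    rw [Function.update_idem]
    exact SameKer.refl _ _

/-- For `u ≠ t` the tree is the path `v`, `u`, `t`, `w`, and `v`, `t` form one side of the
bipartition. Isolating either of them gives the same partition, so `t` can replace `v` as an end if
`v` is forbidden. -/
theorem bellPath_card_four (hW : IsSubtree T W) (hc : W.card = 2) (h : AttachTwo T W v u w t) :
    ∃ b l, BellPath T (insert w (insert v W)) b l v w ∧ 2 ≤ l.length ∧
      (u ≠ t → SameKer (insert w (insert v W)) (Function.update b v 2) (Function.update b t 2)) := by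
  obtain ⟨b, hb, henum⟩ := hW.enumerates_edge hc
  have htv : t ≠ v := by rintro rfl; exact h.left.notMem h.right.mem
  have huw : u ≠ w := by rintro rfl; exact h.right.notMem h.left.mem
  have hvw := h.ne
  have huv := h.left.ne
  have htw := h.right.ne
  have hbu := hb u
  have hbt := hb t
  obtain ⟨c, hcu, hc2⟩ := exists_fin_three (b u) 2 (hb u)
  obtain ⟨d, hdt, hd2⟩ := exists_fin_three (b t) 2 (hb t)
  have path := ((HamPath.single _ _).snoc (step_place_right W v w b 2 d 2)).snoc
    (step_place_left W h.ne b 2 c 2)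
  obtain ⟨l, hl, hlen⟩ := BellPath.of_hamPath (b := place v w b c d) (x := v) (y := w) (T := T)
    (by simp) (by simp) (place_ne_two (W := W) (fun a _ => hb a) hc2 hd2)
    (hW.enumerates_sq hc.ge h henum) path
    (by
      simp only [List.flatMap_cons, List.flatMap_nil, List.append_nil]
      rw [coe_sq (f := b) htv hc2 hd2 hcu hbu.symm hdt hbt.symm]
      abel)
    (by rw [update_place_left h.ne]; exact SameKer.refl _ _)
    (by rw [update_place_right]; exact SameKer.refl _ _)
  refine ⟨_, l, hl, by rw [hlen]; simp, fun hut => ?_⟩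
  have hWut : W = {u, t} := by
    refine (Finset.eq_of_subset_of_card_le ?_ ?_).symm
    · intro a ha
      rcases Finset.mem_insert.1 ha with rfl | ha
      · exact h.left.mem
      · rw [Finset.mem_singleton.1 ha]; exact h.right.mem
    · rw [hc, Finset.card_pair hut]
  obtain ⟨a, ha, hua⟩ := hW.exists_adj hc.ge u h.left.mem
  have hat : a = t := by
    rw [hWut] at ha
    simpa [hua.ne'] using ha
  subst hat
  have hbut : b u ≠ b a := henum.mem b (by simp) h.left.mem h.right.mem hua
  have hca : c = b a := ((fin_three_cases 2 (b u) (b a) hbu.symm hbt hbut.symm c).resolve_left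
    hc2).resolve_left hcu
  have hdu : d = b u := ((fin_three_cases 2 (b a) (b u) hbt.symm hbu hbut d).resolve_left
    hd2).resolve_left hdt
  rw [hWut, update_place_left h.ne, hca, hdu]
  refine SameKer.of_perm (Equiv.swap (b a) 2) fun x hx => ?_
  have hs : Equiv.swap (b a) 2 (b u) = b u := Equiv.swap_apply_of_ne_of_ne hbut hbu
  simp only [Finset.mem_insert, Finset.mem_singleton] at hx
  rcases hx with rfl | rfl | rfl | rfl
  · simp [place, hs, h.right.ne]
  · simp [place, hvw, htv.symm]
  · simp [place, huw, huv.symm, hut, hs]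
  · simp [place, htv, htw.symm]

/-- The corner construction has ends `v`, `w` and needs `u` and `t` fixed when `b` moves to its
neighbour. If instead `x` is `t` or `u`, the path keeps `x` as an end: `no_return`, applied from
`b`, makes the side edge compatible with the next recolouring. -/
theorem bellPath_extend (hW : IsSubtree T W) (hc : 2 ≤ W.card) (h : AttachTwo T W v u w t)
    {b : V → Fin 3} {l : List (V → Fin 3)} {x y : V} (hB : BellPath T W b l x y) (hxz : x ≠ z)
    (hut : u ≠ t ∨ (u = t ∧ ∀ a ∈ W, a ≠ u → T.Adj u a)) (hvz : v ≠ z) (hwz : w ≠ z) :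
    ∃ b l x y, BellPath T (insert w (insert v W)) b l x y ∧ x ≠ z ∧ y ≠ z ∧ 2 ≤ l.length := by
  obtain ⟨l, hB, hch, -⟩ := hB.normalize
  have hbu := hB.ne_two u h.left.mem
  have hbt := hB.ne_two t h.right.mem
  obtain ⟨c, hcu, hc2⟩ := exists_fin_three (b u) 2 hbu
  obtain ⟨d, hdt, hd2⟩ := exists_fin_three (b t) 2 hbt
  have hpw := hB.enum.pairwise
  have hconst : u = t → (b :: Function.update b x 2 :: l).IsChain fun f g => g u = f u := by
    intro e
    exact chain_centre_const (hut.resolve_left fun h => h e).2 h.left.mem _ hB.enum.mem hch hpw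
  have hch' := (List.isChain_cons_cons.1 hch).2
  have hconst' : u = t → (Function.update b x 2 :: l).IsChain fun f g => g u = f u :=
    fun e => (List.isChain_cons_cons.1 (hconst e)).2
  have hxu_of_eq : u = t → x ≠ u := by
    rintro e rfl
    have := (List.isChain_cons_cons.1 (hconst e)).1
    rw [Function.update_self] at this
    exact hbu this.symm
  by_cases hxt : x = t
  · subst hxt
    have hxu : x ≠ u := fun e => hxu_of_eq e.symm e
    have he := edgePath l _ hch' hpw.of_cons v u w x h hconst' d (by simpa using hd2) (by
      intro g hg
      have := no_return (u := x) hch hpw (by simpa using hbt.symm) g hg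
      rw [Function.update_self]
      exact (fin_three_cases (b x) 2 d hbt hdt hd2 (g x)).resolve_left this)
    obtain ⟨l', h1, h2⟩ := bellPath_side hW hc h hB.ne_two hB.mem_left hxu hB.enum hcu hc2 hdt hd2 he
    exact ⟨_, l', x, w, h1, hxz, hwz, h2⟩
  by_cases hxu : x = u
  · subst hxu
    have he := edgePath l _ hch' hpw.of_cons w t v x h.symm (fun e => absurd e (Ne.symm hxt))
      c (by simpa using hc2) (by
      intro g hg
      have := no_return (u := x) hch hpw (by simpa using hbu.symm) g hg
      rw [Function.update_self]
      exact (fin_three_cases (b x) 2 c hbu hcu hc2 (g x)).resolve_left this)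
    obtain ⟨l', h1, h2⟩ := bellPath_side hW hc h.symm hB.ne_two hB.mem_left hxt hB.enum hdt hd2
      hcu hc2 he
    rw [Finset.insert_comm] at h1
    exact ⟨_, l', x, v, h1, hxz, hvz, h2⟩
  · have he := corner_edge h hch' hpw.of_cons hconst'
      (by rwa [Function.update_of_ne (Ne.symm hxu)]) (by rwa [Function.update_of_ne (Ne.symm hxt)])
    obtain ⟨l', h1, h2⟩ := bellPath_corner hW hc h hB.ne_two hB.mem_left hxu hxt hB.enum hcu hc2
      hdt hd2 he
    exact ⟨_, l', v, w, h1, hvz, hwz, h2⟩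

/-- Here `v` may not be an end, so an old end is kept beside `w`. The side construction does this
when an end equals `t` or the path is a single colouring. Otherwise the square at the `x` end is
split off and a corner detour is made at the `y` end. -/
theorem bellPath_extend_leaf (hW : IsSubtree T W) (hc : 2 ≤ W.card) (h : AttachTwo T W v u w t)
    {b : V → Fin 3} {l : List (V → Fin 3)} {x y : V} (hB : BellPath T W b l x y) (hxu : x ≠ u)
    (hyu : y ≠ u) (hut : u ≠ t) :
    ∃ b l x y, BellPath T (insert w (insert v W)) b l x y ∧ x ≠ v ∧ y ≠ v ∧ 2 ≤ l.length := by
  have hbu := hB.ne_two u h.left.mem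
  have hbt := hB.ne_two t h.right.mem
  obtain ⟨c, hcu, hc2⟩ := exists_fin_three (b u) 2 hbu
  obtain ⟨d, hdt, hd2⟩ := exists_fin_three (b t) 2 hbt
  have hxv : ∀ {x}, x ∈ W → x ≠ v := by rintro x hx rfl; exact h.left.notMem hx
  have side : ∀ {x y l}, BellPath T W b (Function.update b x 2 :: l) x y →
      (b :: Function.update b x 2 :: l).IsChain (Move W) → x ≠ u → (x = t ∨ l = []) →
      ∃ b l x y, BellPath T (insert w (insert v W)) b l x y ∧ x ≠ v ∧ y ≠ v ∧ 2 ≤ l.length := by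
    intro x y l hB hch hxu hor
    have hpw := hB.enum.pairwise
    have hch' := (List.isChain_cons_cons.1 hch).2
    have he : EdgePath W v u w t (Function.update b x 2) (Function.update b x 2 :: l) d := by
      refine edgePath l _ hch' hpw.of_cons v u w t h (fun e => absurd e hut) d ?_ ?_
      · by_cases hxt : t = x
        · subst hxt; simpa using hd2
        · rwa [Function.update_of_ne hxt]
      · intro g hg
        rcases hor with rfl | rfl
        · have := no_return (u := x) hch hpw (by simpa using hbt.symm) g hg
          rw [Function.update_self]
          exact (fin_three_cases (b x) 2 d hbt hdt hd2 (g x)).resolve_left this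
        · simp at hg
    obtain ⟨l', h1, h2⟩ := bellPath_side hW hc h hB.ne_two hB.mem_left hxu hB.enum hcu hc2 hdt hd2 he
    exact ⟨_, l', x, w, h1, hxv hB.mem_left, h.ne.symm, h2⟩
  obtain ⟨l₁, hB₁, hch₁, -⟩ := hB.normalize
  obtain ⟨l₂, hB₂, hch₂, hlen⟩ := hB₁.symm.normalize
  by_cases h1 : x = t ∨ l₁ = []
  · exact side hB₁ hch₁ hxu h1
  by_cases h2 : y = t ∨ l₂ = []
  · exact side hB₂ hch₂ hyu h2
  push Not at h1 h2
  obtain ⟨l₃, g, rfl⟩ := (List.eq_nil_or_concat l₂).resolve_left h2.2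
  rw [List.concat_eq_append] at hB₂ hch₂
  have hg : SameKer W g (Function.update b x 2) := by
    obtain ⟨q, hq, hqx⟩ := hB₂.last
    rw [← List.cons_append, List.getLast?_append] at hq
    have : g = q := by simpa using hq
    exact this ▸ hqx
  have henum : Enumerates W (Proper T W)
      (Function.update b x 2 :: b :: Function.update b y 2 :: l₃) := by
    have e1 : Enumerates W (Proper T W) (g :: b :: Function.update b y 2 :: l₃) :=
      hB₂.enum.perm (by
        simpa using (List.perm_append_singleton g (b :: Function.update b y 2 :: l₃)))
    refine e1.forall₂ (kerInvariant_proper T W) (List.Forall₂.cons hg ?_)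
    exact List.forall₂_same.2 fun f _ => SameKer.refl W f
  have hch₃ : (Function.update b y 2 :: l₃).IsChain (Move W) := by
    have := (List.isChain_cons_cons.1 hch₂).2
    rw [← List.cons_append] at this
    exact (List.isChain_append.1 this).1
  have he := corner_edge h hch₃ henum.pairwise.of_cons.of_cons (fun e => absurd e hut)
    (by rwa [Function.update_of_ne (Ne.symm hyu)]) (by rwa [Function.update_of_ne h2.1.symm])
  obtain ⟨l', h3, h4⟩ := bellPath_pendant hW hc h hB.ne_two hB.mem_left hxu h1.1 hB.mem_right hyu
    h2.1 henum hcu hc2 hdt hd2 he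
  exact ⟨_, l', x, w, h3, hxv hB.mem_left, h.ne.symm, h4⟩

/-- The partitions of a tree into three independent sets form a path whose ends are obtained from
the bipartition by separating one vertex, which may be required to differ from `z`. -/
theorem IsSubtree.exists_bellPath (n : ℕ) : ∀ {W : Finset V}, W.card = n → IsSubtree T W → 3 ≤ n →
    ∀ z, ∃ b l x y, BellPath T W b l x y ∧ x ≠ z ∧ y ≠ z ∧ (4 ≤ n → 2 ≤ l.length) := by
  induction n using Nat.strong_induction_on with
  | _ n ih =>
    intro W hcard hW hn z
    by_cases h3 : n = 3
    · obtain ⟨W₀, v, u, hW₀, h, rfl, hvz⟩ := hW.exists_attach_ne (by omega) z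
      rw [Finset.card_insert_of_notMem h.notMem] at hcard
      obtain ⟨b, l, hB⟩ := bellPath_card_three hW₀ (by omega) h
      exact ⟨b, l, v, v, hB, hvz, hvz, by omega⟩
    obtain ⟨W₀, v, u, w, t, hW₀, h, rfl, hwz, hut⟩ := hW.exists_attachTwo (by omega) z
    rw [Finset.card_insert_of_notMem h.attach.notMem, Finset.card_insert_of_notMem h.left.notMem]
      at hcard
    by_cases h4 : n = 4
    · obtain ⟨b, l, hB, hlen, hvt⟩ := bellPath_card_four hW₀ (by omega) h
      by_cases hvz : v = z
      · subst hvz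
        have hut' : u ≠ t := hut.resolve_right fun h => h.1 rfl
        obtain ⟨p, hp, hpv⟩ := hB.head
        refine ⟨b, l, t, w, ⟨by simp [h.right.mem], hB.mem_right, hB.ne_two, hB.enum, hB.chain,
          ⟨p, hp, hpv.trans (hvt hut')⟩, hB.last⟩, ?_, hwz, fun _ => hlen⟩
        rintro rfl
        exact h.left.notMem h.right.mem
      · exact ⟨b, l, v, w, hB, hvz, hwz, fun _ => hlen⟩
    by_cases hvz : v = z
    · subst hvz
      have hut' : u ≠ t := hut.resolve_right fun h => h.1 rfl
      -- The new leaf `v` is the forbidden vertex; old ends avoid it automatically, but extending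
      -- while keeping one of them requires that it is not `u`.
      obtain ⟨b, l, x, y, hB, hx, hy, -⟩ := ih W₀.card (by omega) rfl hW₀ (by omega) u
      obtain ⟨b, l, x, y, h1, h2, h3, h4⟩ := bellPath_extend_leaf hW₀ (by omega) h hB hx hy hut'
      exact ⟨b, l, x, y, h1, h2, h3, fun _ => h4⟩
    · obtain ⟨b, l, x, y, hB, hx, hy, -⟩ := ih W₀.card (by omega) rfl hW₀ (by omega) z
      obtain ⟨b, l, x, y, h1, h2, h3, h4⟩ := bellPath_extend hW₀ (by omega) h hB hx
        (hut.imp_right And.right) hvz hwz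
      exact ⟨b, l, x, y, h1, h2, h3, fun _ => h4⟩

/-! ### Four-colourings of a tree -/

/-- `f` is a proper colouring of the subgraph induced on `W` that uses every colour. -/
def Onto (T : SimpleGraph V) (W : Finset V) (f : V → Fin k) : Prop :=
  Proper T W f ∧ ∀ c, ∃ x ∈ W, f x = c

theorem kerInvariant_onto (T : SimpleGraph V) (W : Finset V) :
    KerInvariant W (Onto (k := k) T W) := by
  intro f g hfg hf
  refine ⟨kerInvariant_proper T W hfg hf.1, fun c => ?_⟩
  obtain ⟨σ, hσ⟩ := hfg.exists_perm
  obtain ⟨x, hx, hxc⟩ := hf.2 (σ.symm c)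
  exact ⟨x, hx, by rw [← hσ x hx, hxc, Equiv.apply_symm_apply]⟩

/-- The partitions of `W` into four independent sets can be listed cyclically. -/
def StirlingCycle (T : SimpleGraph V) (W : Finset V) : Prop :=
  ∃ (a : V → Fin 4) (L : List (V → Fin 4)), Enumerates W (Onto T W) (a :: L) ∧
    (a :: (L ++ [a])).IsChain (Step W) ∧
    -- A cycle with exactly two entries is excluded, so the two neighbours of an entry are different
    -- unless there are none.
    ((L = [] ∧ W.card = 4) ∨ 2 ≤ L.length)

theorem StirlingCycle.rotate (h : StirlingCycle T W) {p : V → Fin 4} (hp : Onto T W p) :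
    ∃ a L, Enumerates W (Onto T W) (a :: L) ∧ (a :: (L ++ [a])).IsChain (Step W) ∧
      (L = [] ∨ 2 ≤ L.length) ∧ SameKer W a p := by
  obtain ⟨a, L, hL, hch, hlen⟩ := h
  obtain ⟨f, hf, hfp⟩ := hL.complete p hp
  obtain ⟨A, B, hAB⟩ := List.append_of_mem hf
  have hperm : (a :: L).Perm (f :: (B ++ A)) := by
    rw [hAB]; exact List.perm_append_comm
  refine ⟨f, B ++ A, hL.perm hperm, ?_, ?_, hfp⟩
  · rw [← Cycle.chain_coe_cons] at hch ⊢
    have : ((a :: L : List (V → Fin 4)) : Cycle (V → Fin 4)) = (f :: (B ++ A) : List _) := by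
      rw [Cycle.coe_eq_coe, hAB]
      exact List.isRotated_append
    rwa [← this]
  · have := hperm.length_eq
    simp only [List.length_cons] at this
    rcases hlen with ⟨rfl, -⟩ | hlen
    · left
      exact List.eq_nil_of_length_eq_zero (by simp at this; simp [this])
    · right; omega

theorem twoColoured_of_avoid {f : V → Fin 3} (i : Fin 3) (hf : ∀ a ∈ W, f a ≠ i) :
    TwoColoured W f := by
  intro a ha b hb c hc hab
  have := hf a ha; have := hf b hb; have := hf c hc
  omega

/-- If `x` and `y` exhausted a side of `b`, then isolating one of them would give `b` again, or
isolating `x` and isolating `y` would give the same partition. Both contradict the enumeration. Thus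
`separate b x y` really has four cells. -/
theorem BellPath.exists_mem_colour {b : V → Fin 3} {l : List (V → Fin 3)} {x y : V}
    (hB : BellPath T W b l x y) (hW : IsSubtree T W) (hc : 2 ≤ W.card) (hl : 2 ≤ l.length)
    {i : Fin 3} (hi : i ≠ 2) : ∃ s ∈ W, s ≠ x ∧ s ≠ y ∧ b s = i := by
  by_contra hcon
  push Not at hcon
  have hpw := hB.enum.pairwise
  rw [List.pairwise_cons] at hpw
  obtain ⟨p, hp, hpx⟩ := hB.head
  obtain ⟨q, hq, hqy⟩ := hB.last
  have hbx : ¬ SameKer W b (Function.update b x 2) := fun h =>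
    hpw.1 p (List.mem_of_mem_head? hp) (h.trans hpx.symm)
  have hby : ¬ SameKer W b (Function.update b y 2) := fun h =>
    hpw.1 q (List.mem_of_mem_getLast? hq) (h.trans hqy.symm)
  have hxy : ¬ SameKer W (Function.update b x 2) (Function.update b y 2) := by
    intro h
    obtain ⟨p', l', rfl⟩ : ∃ p' l', l = p' :: l' := by
      cases l with
      | nil => simp at hl
      | cons a l => exact ⟨a, l, rfl⟩
    obtain ⟨l'', q', rfl⟩ := (List.eq_nil_or_concat l').resolve_left (by rintro rfl; simp at hl)
    rw [List.concat_eq_append] at *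
    have e1 : p' = p := by simpa using hp
    have e2 : q' = q := by
      rw [← List.cons_append, List.getLast?_append] at hq
      simpa using hq
    subst e1; subst e2
    exact (List.pairwise_cons.1 hpw.2).1 q' (by simp) ((hpx.trans h).trans hqy.symm)
  by_cases hxi : b x = i <;> by_cases hyi : b y = i
  · refine hxy (SameKer.of_perm (Equiv.swap i 2) fun s hs => ?_)
    by_cases hsx : s = x
    · subst hsx
      by_cases hsy : s = y
      · subst hsy
        exact absurd (SameKer.refl W _) hxy
      · simp [hsy, hxi]
    · by_cases hsy : s = y
      · subst hsy
        simp [hsx, hyi]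
      · rw [Function.update_of_ne hsx, Function.update_of_ne hsy]
        exact Equiv.swap_apply_of_ne_of_ne (hcon s hs hsx hsy) (hB.ne_two s hs)
  · refine hbx (SameKer.of_perm (Equiv.swap i 2) fun s hs => ?_)
    by_cases hsx : s = x
    · subst hsx; simp [hxi]
    · rw [Function.update_of_ne hsx]
      refine Equiv.swap_apply_of_ne_of_ne ?_ (hB.ne_two s hs)
      by_cases hsy : s = y
      · rwa [hsy]
      · exact hcon s hs hsx hsy
  · refine hby (SameKer.of_perm (Equiv.swap i 2) fun s hs => ?_)
    by_cases hsy : s = y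
    · subst hsy; simp [hyi]
    · rw [Function.update_of_ne hsy]
      refine Equiv.swap_apply_of_ne_of_ne ?_ (hB.ne_two s hs)
      by_cases hsx : s = x
      · rwa [hsx]
      · exact hcon s hs hsx hsy
  · have hno : ∀ s ∈ W, b s ≠ i := by
      intro s hs
      by_cases hsx : s = x
      · rwa [hsx]
      · by_cases hsy : s = y
        · rwa [hsy]
        · exact hcon s hs hsx hsy
    obtain ⟨s, hs⟩ := hW.nonempty
    obtain ⟨s', hs', hss⟩ := hW.exists_adj hc s hs
    have h1 := hB.enum.mem b (by simp) hs hs' hss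
    have h2 := hno s hs
    have h3 := hno s' hs'
    have h4 := hB.ne_two s hs
    have h5 := hB.ne_two s' hs'
    omega

/-- The four-colouring in which `x` and `y` are alone in their cells, and which agrees with `b`
elsewhere. -/
def separate (b : V → Fin 3) (x y : V) : V → Fin 4 :=
  Function.update (Function.update (fun s => (b s).castSucc) x 2) y 3

/-- The four-colouring in which `v` is alone in its cell, and which agrees with `f` elsewhere. -/
def isolate (v : V) (f : V → Fin 3) : V → Fin 4 := Function.update (fun s => (f s).castSucc) v 3

/-! ### Links between the two kinds of four-cell partitions -/

section Separate

variable {b : V → Fin 3} {x y : V}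

theorem separate_right : separate b x y y = 3 := by simp [separate]

theorem separate_left (h : x ≠ y) : separate b x y x = 2 := by simp [separate, h]

theorem separate_of_ne {s : V} (hx : s ≠ x) (hy : s ≠ y) : separate b x y s = (b s).castSucc := by
  simp [separate, hx, hy]

theorem isolate_self (v : V) (f : V → Fin 3) : isolate v f v = 3 := by simp [isolate]

theorem isolate_of_ne {s : V} (hs : s ≠ v) (f : V → Fin 3) : isolate v f s = (f s).castSucc := by
  simp [isolate, hs]

theorem castSucc_ne_three : ∀ i : Fin 3, i.castSucc ≠ (3 : Fin 4) := by decide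

theorem castSucc_ne_two {i : Fin 3} (h : i ≠ 2) : i.castSucc ≠ (2 : Fin 4) := by
  revert i; decide

theorem separate_onto (hxy : x ≠ y) (hx : x ∈ W) (hy : y ∈ W) (hb : Proper T W b)
    (hb2 : ∀ a ∈ W, b a ≠ 2) (hex : ∀ i : Fin 3, i ≠ 2 → ∃ s ∈ W, s ≠ x ∧ s ≠ y ∧ b s = i) :
    Onto T W (separate b x y) := by
  constructor
  · have key : ∀ s ∈ W, ∀ s' ∈ W, s ≠ s' → separate b x y s = separate b x y s' → b s = b s' := by
      intro s hs s' hs' hne h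
      have h3 := castSucc_ne_three (b s)
      have h3' := castSucc_ne_three (b s')
      have h2 := castSucc_ne_two (hb2 s hs)
      have h2' := castSucc_ne_two (hb2 s' hs')
      by_cases e1 : s = y
      · subst e1
        rw [separate_right] at h
        by_cases e2 : s' = x
        · subst e2; rw [separate_left hxy] at h; exact absurd h (by decide)
        · rw [separate_of_ne e2 hne.symm] at h; exact absurd h.symm h3'
      · by_cases e2 : s' = y
        · subst e2
          rw [separate_right] at h
          by_cases e3 : s = x
          · subst e3; rw [separate_left hxy] at h; exact absurd h (by decide)
          · rw [separate_of_ne e3 e1] at h; exact absurd h h3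
        · by_cases e3 : s = x
          · subst e3
            rw [separate_left hxy, separate_of_ne hne.symm e2] at h
            exact absurd h.symm h2'
          · rw [separate_of_ne e3 e1] at h
            by_cases e4 : s' = x
            · subst e4
              rw [separate_left hxy] at h
              exact absurd h h2
            · rw [separate_of_ne e4 e2] at h
              exact Fin.castSucc_injective _ h
    exact fun s hs s' hs' h e => hb hs hs' h (key s hs s' hs' h.ne e)
  · have h4 : ∀ c : Fin 4, c = 3 ∨ c = 2 ∨ ∃ i : Fin 3, i ≠ 2 ∧ i.castSucc = c := by decide
    intro c
    rcases h4 c with rfl | rfl | ⟨i, hi, rfl⟩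
    · exact ⟨y, hy, separate_right⟩
    · exact ⟨x, hx, separate_left hxy⟩
    · obtain ⟨s, hs, hsx, hsy, rfl⟩ := hex i hi
      exact ⟨s, hs, separate_of_ne hsx hsy⟩

theorem Step.isolate {f g : V → Fin 3} (h : Step W f g) (hv : v ∉ W) :
    Step (insert v W) (isolate v f) (isolate v g) := by
  obtain ⟨x, hx, h⟩ := h
  have hxv : v ≠ x := by rintro rfl; exact hv hx
  refine ⟨x, Finset.mem_insert_of_mem hx, ?_⟩
  intro s hs s' hs'
  rw [Finset.erase_insert_of_ne hxv, Finset.mem_insert] at hs hs'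
  have hne : ∀ {a}, a ∈ W.erase x → a ≠ v := by
    rintro a ha rfl; exact hv (Finset.mem_of_mem_erase ha)
  rcases hs with rfl | hs <;> rcases hs' with rfl | hs'
  · simp
  · rw [isolate_self, isolate_self, isolate_of_ne (hne hs'), isolate_of_ne (hne hs')]
    simp [(castSucc_ne_three _).symm]
  · rw [isolate_self, isolate_self, isolate_of_ne (hne hs), isolate_of_ne (hne hs)]
    simp [castSucc_ne_three]
  · rw [isolate_of_ne (hne hs), isolate_of_ne (hne hs), isolate_of_ne (hne hs'),
      isolate_of_ne (hne hs'), Fin.castSucc_inj, Fin.castSucc_inj]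
    exact h hs hs'

theorem sameKer_isolate {f g : V → Fin 3} (hv : v ∉ W) :
    SameKer (insert v W) (isolate v f) (isolate v g) ↔ SameKer W f g := by
  have hne : ∀ {s}, s ∈ W → s ≠ v := by
    rintro s hs rfl; exact hv hs
  constructor
  · intro h s hs s' hs'
    have := h (Finset.mem_insert_of_mem hs) (Finset.mem_insert_of_mem hs')
    rwa [isolate_of_ne (hne hs), isolate_of_ne (hne hs), isolate_of_ne (hne hs'),
      isolate_of_ne (hne hs'), Fin.castSucc_inj, Fin.castSucc_inj] at this
  · intro h s hs s' hs'
    rw [Finset.mem_insert] at hs hs'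
    rcases hs with rfl | hs <;> rcases hs' with rfl | hs'
    · simp
    · rw [isolate_self, isolate_self, isolate_of_ne (hne hs'), isolate_of_ne (hne hs')]
      simp [(castSucc_ne_three _).symm]
    · rw [isolate_self, isolate_self, isolate_of_ne (hne hs), isolate_of_ne (hne hs)]
      simp [castSucc_ne_three]
    · rw [isolate_of_ne (hne hs), isolate_of_ne (hne hs), isolate_of_ne (hne hs'),
        isolate_of_ne (hne hs'), Fin.castSucc_inj, Fin.castSucc_inj]
      exact h hs hs'

/-- The moved vertex is `y`: it leaves the cell shared with `v` for its side of `b`. -/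
theorem step_separate_left (hv : v ∉ W) (hx : x ∈ W) (hy : y ∈ W) (hxy : x ≠ y) :
    Step (insert v W) (Function.update (separate b x y) v 3)
      (isolate v (Function.update b x 2)) := by
  have hxv : x ≠ v := by rintro rfl; exact hv hx
  refine Step.of_eq (Finset.mem_insert_of_mem hy) fun s hs hsy => ?_
  by_cases hsv : s = v
  · subst hsv; simp [isolate_self]
  · rw [Function.update_of_ne hsv, isolate_of_ne hsv]
    by_cases hsx : s = x
    · subst hsx
      rw [separate_left hxy, Function.update_self]; rfl
    · rw [separate_of_ne hsx hsy, Function.update_of_ne hsx]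

/-- The moved vertex is `x`, which joins `v`; the colours 2 and 3 are exchanged on the way. -/
theorem step_separate_right (hv : v ∉ W) (hx : x ∈ W) (hb2 : ∀ a ∈ W, b a ≠ 2)
    (hyv : y ≠ v) :
    Step (insert v W) (isolate v (Function.update b y 2))
      (Function.update (separate b x y) v 2) := by
  refine ⟨x, Finset.mem_insert_of_mem hx, SameKer.of_perm (Equiv.swap 2 3) fun s hs => ?_⟩
  rw [Finset.mem_erase] at hs
  by_cases hsv : s = v
  · subst hsv; simp [isolate_self]
  · have hsW : s ∈ W := (Finset.mem_insert.1 hs.2).resolve_left hsv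
    rw [Function.update_of_ne hsv, isolate_of_ne hsv]
    by_cases hsy : s = y
    · subst hsy
      rw [separate_right, Function.update_self]
      decide
    · rw [separate_of_ne hs.1 hsy, Function.update_of_ne hsy]
      exact Equiv.swap_apply_of_ne_of_ne (castSucc_ne_two (hb2 s hsW)) (castSucc_ne_three _)

end Separate

/-- A cyclic list of partitions can be opened at `p`, in one of the two directions, so that `u` is
not moved between two cells with prescribed distinct colours in the first step. -/
theorem StirlingCycle.exists_moves (h : StirlingCycle T W) {p : V → Fin 4} (hp : Onto T W p)
    {c d : Fin 4} (hcd : c ≠ d) (hc : c ≠ p u) (hd : d ≠ p u) :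
    ∃ M, Enumerates W (Onto T W) (p :: M) ∧ (p :: M).IsChain (Move W) ∧
      ∀ g ∈ M.head?, g u = p u ∨ g u = c ∨ g u = d := by
  obtain ⟨a, L, hL, hch, hlen, hap⟩ := h.rotate hp
  have hch₁ : (a :: L).IsChain (Step W) := by
    rw [← List.cons_append] at hch
    exact (List.isChain_append.1 hch).1
  have hch₂ : (a :: L.reverse).IsChain (Step W) := by
    have := (hch.imp (S := fun f g => Step W g f) fun _ _ h => h.symm)
    rw [← List.isChain_reverse] at this
    simp only [List.reverse_cons, List.reverse_append, List.reverse_nil, List.nil_append,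
      List.singleton_append] at this
    exact (List.isChain_append.1 this).1
  have hL₂ : Enumerates W (Onto T W) (a :: L.reverse) := hL.perm ((List.reverse_perm L).symm.cons a)
  have aux : ∀ L, Enumerates W (Onto T W) (a :: L) → (a :: L).IsChain (Step W) →
      (∃ M, Enumerates W (Onto T W) (p :: M) ∧ (p :: M).IsChain (Move W) ∧
        ∀ g ∈ M.head?, g u = p u ∨ g u = c ∨ g u = d) ∨
      ∃ f ∈ L.head?, ∃ e, e ≠ p u ∧ e ≠ c ∧ e ≠ d ∧ SameKer W f (Function.update p u e) := by
    intro L hL hch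
    obtain ⟨M, hM, hLM⟩ := StirlingGray.exists_moves a p L hch hap
    by_cases hgood : ∀ g ∈ M.head?, g u = p u ∨ g u = c ∨ g u = d
    · exact Or.inl ⟨M, hL.forall₂ (kerInvariant_onto T W) (List.Forall₂.cons hap hLM), hM, hgood⟩
    · right
      push Not at hgood
      obtain ⟨g, hg, h1, h2, h3⟩ := hgood
      cases hLM with
      | nil => simp at hg
      | @cons f g' L M hfg _ =>
        simp only [List.head?_cons, Option.mem_some_iff] at hg
        subst hg
        refine ⟨f, rfl, g' u, h1, h2, h3, ?_⟩
        rwa [← (List.isChain_cons_cons.1 hM).1.eq_update h1]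
  rcases aux L hL hch₁ with hgood | ⟨f, hf, e, he1, he2, he3, hfe⟩
  · exact hgood
  rcases aux L.reverse hL₂ hch₂ with hgood | ⟨f', hf', e', he1', he2', he3', hfe'⟩
  · exact hgood
  exfalso
  -- Only one colour differs from `p u`, `c` and `d`, so if both directions were bad, the two cyclic
  -- neighbours of `p` would be the same partition.
  have hee : e = e' := by omega
  subst hee
  have hff := hfe.trans hfe'.symm
  have hpw := hL.pairwise.of_cons
  have hlen : 2 ≤ L.length := hlen.resolve_left (by rintro rfl; simp at hf)
  obtain ⟨f₁, L', rfl⟩ : ∃ f₁ L', L = f₁ :: L' := by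
    cases L with
    | nil => simp at hlen
    | cons a l => exact ⟨a, l, rfl⟩
  obtain ⟨L'', f₂, rfl⟩ := (List.eq_nil_or_concat L').resolve_left (by rintro rfl; simp at hlen)
  have h1 : f₁ = f := by simpa using hf
  have h2 : f₂ = f' := by simpa using hf'
  subst h1; subst h2
  exact (List.pairwise_cons.1 hpw).1 f₂ (by simp) hff

theorem Onto.grow (h : Attach T W v u) {f : V → Fin k} (hf : Onto T W f) (hfv : f v ≠ f u) :
    Onto T (insert v W) f := by
  refine ⟨h.proper_insert.2 ⟨hf.1, hfv⟩, fun c => ?_⟩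
  obtain ⟨s, hs, hsc⟩ := hf.2 c
  exact ⟨s, Finset.mem_insert_of_mem hs, hsc⟩

/-- A colouring missing a colour is two-coloured, hence is the bipartition `b`, which is not in `l`.
-/
theorem BellPath.onto {b : V → Fin 3} {l : List (V → Fin 3)} {x y : V} (hB : BellPath T W b l x y)
    (hW : IsSubtree T W) {f : V → Fin 3} (hf : f ∈ l) (i : Fin 3) : ∃ s ∈ W, f s = i := by
  by_contra hcon
  push Not at hcon
  refine (List.pairwise_cons.1 hB.enum.pairwise).1 f hf ?_
  exact hW.sameKer_of_twoColoured (hB.enum.mem b (by simp))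
    (hB.enum.mem f (List.mem_cons_of_mem _ hf)) (twoColoured_of_avoid 2 hB.ne_two)
    (twoColoured_of_avoid i hcon)

/-- In a partition of a tree with a new leaf `v` into four cells, either `v` is added to a cell of
a partition of the tree into four cells, or `v` is alone in its cell. -/
theorem enumerates_insert (hW : IsSubtree T W) (h : Attach T W v u) {b : V → Fin 3}
    {l : List (V → Fin 3)} {x y : V} (hB : BellPath T W b l x y) {M : List (V → Fin 4)}
    (hM : Enumerates W (Onto T W) M) :
    Enumerates (insert v W) (Onto T (insert v W)) (M.flatMap (fib v u) ++ l.map (isolate v)) := by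
  have hne : ∀ {a}, a ∈ W → a ≠ v := by rintro a ha rfl; exact h.notMem ha
  have e₁ := hM.flatMap_fib (kerInvariant_onto T W) h.notMem h.mem fun f hf => by
    have : W.image f = Finset.univ := Finset.eq_univ_iff_forall.2 fun c => by
      obtain ⟨s, hs, hsc⟩ := hf.2 c
      exact Finset.mem_image.2 ⟨s, hs, hsc⟩
    rw [this]; simp
  refine ⟨?_, ?_, ?_⟩
  · intro f hf
    rcases List.mem_append.1 hf with hf | hf
    · exact Onto.grow h (e₁.mem f hf).1 (e₁.mem f hf).2
    · obtain ⟨g, hg, rfl⟩ := List.mem_map.1 hf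
      constructor
      · refine h.proper_insert.2 ⟨fun s hs s' hs' hss => ?_, ?_⟩
        · rw [isolate_of_ne (hne hs), isolate_of_ne (hne hs'), Ne, Fin.castSucc_inj]
          exact hB.enum.mem g (List.mem_cons_of_mem _ hg) hs hs' hss
        · rw [isolate_self, isolate_of_ne h.ne.symm]
          exact (castSucc_ne_three _).symm
      · have h4 : ∀ c : Fin 4, c = 3 ∨ ∃ i : Fin 3, i.castSucc = c := by decide
        intro c
        rcases h4 c with rfl | ⟨i, rfl⟩
        · exact ⟨v, Finset.mem_insert_self _ _, isolate_self v g⟩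
        · obtain ⟨s, hs, rfl⟩ := hB.onto hW hg i
          exact ⟨s, Finset.mem_insert_of_mem hs, isolate_of_ne (hne hs) g⟩
  · rw [List.pairwise_append]
    refine ⟨e₁.pairwise, ?_, ?_⟩
    · rw [List.pairwise_map]
      exact hB.enum.pairwise.of_cons.imp fun hfg h' => hfg ((sameKer_isolate h.notMem).1 h')
    · intro f hf g hg hfg
      obtain ⟨g, -, rfl⟩ := List.mem_map.1 hg
      obtain ⟨s, hs, hsv⟩ := (e₁.mem f hf).1.2 (f v)
      have := (hfg (Finset.mem_insert_of_mem hs) (Finset.mem_insert_self v W)).1 hsv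
      rw [isolate_self, isolate_of_ne (hne hs)] at this
      exact castSucc_ne_three _ this
  · intro g hg
    have hgp := h.proper_insert.1 hg.1
    by_cases hsurj : ∀ c, ∃ s ∈ W, g s = c
    · obtain ⟨f, hf, hfg⟩ := e₁.complete g ⟨⟨hgp.1, hsurj⟩, hgp.2⟩
      exact ⟨f, List.mem_append_left _ hf, hfg⟩
    · push Not at hsurj
      obtain ⟨c, hc⟩ := hsurj
      have hgv : g v = c := by
        obtain ⟨s, hs, hsc⟩ := hg.2 c
        rcases Finset.mem_insert.1 hs with rfl | hs
        · exact hsc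
        · exact absurd hsc (hc s hs)
      -- The colour of `v` occurs nowhere on `W`; naming it 3 leaves a colouring of `W` by the other
      -- three colours.
      let σ := Equiv.swap (g v) 3
      have hσ : ∀ s ∈ W, σ (g s) ≠ Fin.last 3 := by
        intro s hs e
        have : σ (g s) = σ (g v) := by
          rw [e]; simp [σ]
        exact hc s hs ((σ.injective this).trans hgv)
      have hex : ∀ s, ∃ i : Fin 3, s ∈ W → i.castSucc = σ (g s) := by
        intro s
        by_cases hs : s ∈ W
        · exact ⟨(σ (g s)).castPred (hσ s hs), fun _ => Fin.castSucc_castPred _ _⟩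
        · exact ⟨0, fun h => absurd h hs⟩
      choose g' hg' using hex
      have hgg' : ∀ s ∈ W, ∀ s' ∈ W, (g s = g s' ↔ g' s = g' s') := by
        intro s hs s' hs'
        rw [← Fin.castSucc_inj (a := g' s), hg' s hs, hg' s' hs', σ.injective.eq_iff]
      obtain ⟨f, hf, hfg⟩ := hB.enum.complete g'
        fun s hs s' hs' hss e => hgp.1 hs hs' hss ((hgg' s hs s' hs').2 e)
      -- All three colours occur in `g'`, whereas `b` avoids 2.
      have hfl : f ∈ l := by
        refine (List.mem_cons.1 hf).resolve_left ?_
        rintro rfl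
        have h1 : W.image g' = Finset.univ := Finset.eq_univ_iff_forall.2 fun i => by
          obtain ⟨s, hs, hsi⟩ := hg.2 (σ.symm i.castSucc)
          have hsv : s ≠ v := by
            rintro rfl
            rw [Equiv.eq_symm_apply] at hsi
            simp only [σ, Equiv.swap_apply_left] at hsi
            exact castSucc_ne_three i hsi.symm
          have hsW : s ∈ W := (Finset.mem_insert.1 hs).resolve_left hsv
          refine Finset.mem_image.2 ⟨s, hsW, ?_⟩
          rw [← Fin.castSucc_inj, hg' s hsW, hsi, Equiv.apply_symm_apply]
        have h2 : W.image f ⊆ Finset.univ.erase 2 := by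
          intro i hi
          obtain ⟨s, hs, rfl⟩ := Finset.mem_image.1 hi
          exact Finset.mem_erase.2 ⟨hB.ne_two s hs, Finset.mem_univ _⟩
        have h3 := Finset.card_le_card h2
        rw [hfg.card_image, h1] at h3
        simp at h3
      refine ⟨isolate v f, List.mem_append_right _ (List.mem_map_of_mem hfl), ?_⟩
      refine SameKer.trans ((sameKer_isolate h.notMem).2 hfg) (SameKer.symm ?_)
      refine SameKer.of_perm σ fun s hs => ?_
      rcases Finset.mem_insert.1 hs with rfl | hs
      · simp [σ, isolate_self]
      · rw [isolate_of_ne (hne hs), hg' s hs]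

theorem StirlingCycle.grow (hS : StirlingCycle T W) (hW : IsSubtree T W) (hc : 4 ≤ W.card)
    (h : Attach T W v u) : StirlingCycle T (insert v W) := by
  obtain ⟨b, l, x, y, hB, hxu, hyu, hl⟩ := IsSubtree.exists_bellPath W.card rfl hW (by omega) u
  have hex := fun (i : Fin 3) (hi : i ≠ 2) => hB.exists_mem_colour hW (by omega) (hl hc) hi
  have hxy : x ≠ y := by
    rintro rfl
    have hpw := hB.enum.pairwise.of_cons
    obtain ⟨p, hp, hpx⟩ := hB.head
    obtain ⟨q, hq, hqx⟩ := hB.last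
    have hl' := hl hc
    cases l with
    | nil => simp at hp
    | cons p' l =>
      obtain ⟨l', q', rfl⟩ := (List.eq_nil_or_concat l).resolve_left (by rintro rfl; simp at hl')
      have h1 : p' = p := by simpa using hp
      have h2 : q' = q := by
        rw [List.concat_eq_append, ← List.cons_append, List.getLast?_append] at hq
        simpa using hq
      subst h1; subst h2
      exact (List.pairwise_cons.1 hpw).1 q' (by simp) (hpx.trans hqx.symm)
  have hp := separate_onto hxy hB.mem_left hB.mem_right (hB.enum.mem b (by simp)) hB.ne_two hex
  have hpu : separate b x y u = (b u).castSucc := separate_of_ne hxu.symm hyu.symm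
  have h2 : (2 : Fin 4) ≠ separate b x y u := by
    rw [hpu]; exact (castSucc_ne_two (hB.ne_two u h.mem)).symm
  have h3 : (3 : Fin 4) ≠ separate b x y u := by
    rw [hpu]; exact (castSucc_ne_three _).symm
  obtain ⟨M, hM, hMch, hMu⟩ := hS.exists_moves hp (by decide) h2 h3
  have hyv : y ≠ v := by rintro rfl; exact h.notMem hB.mem_right
  obtain ⟨p, hpl, hpx⟩ := hB.head
  obtain ⟨q, hql, hqy⟩ := hB.last
  have iso : HamPath (Step (insert v W)) (isolate v p) (isolate v q) (l.map (isolate v) : List _) :=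
    ⟨l.map (isolate v), by
      rw [List.isChain_map]
      exact hB.chain.imp fun _ _ h' => h'.isolate h.notMem,
      by simp [Option.mem_def.1 hpl], by simp [Option.mem_def.1 hql], rfl⟩
  have hstep₁ : Step (insert v W) (Function.update (separate b x y) v 3) (isolate v p) :=
    (step_separate_left h.notMem hB.mem_left hB.mem_right hxy).congr_right
      ((sameKer_isolate h.notMem).2 hpx.symm)
  have hstep₂ : Step (insert v W) (isolate v q) (Function.update (separate b x y) v 2) :=
    (step_separate_right h.notMem hB.mem_left hB.ne_two hyv).congr_left
      ((sameKer_isolate h.notMem).2 hqy.symm)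
  obtain ⟨R, hR, hR0, hRl, hRM⟩ :=
    (triangle_path v u M _ hMch hM.pairwise 2 3 (by decide) h2 h3 hMu).append hstep₁ iso
  have henum := (enumerates_insert hW h hB hM).perm
    (Multiset.coe_eq_coe.1 (by rw [hRM, Multiset.coe_add])) (L' := R)
  cases R with
  | nil => simp at hR0
  | cons r R =>
    have hr : r = Function.update (separate b x y) v 2 := by simpa using hR0
    refine ⟨r, R, henum, ?_, Or.inr ?_⟩
    · rw [← List.cons_append, List.isChain_append]
      refine ⟨hR, by simp, ?_⟩
      rw [hRl, hr]
      simpa using hstep₂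
    · have := congrArg Multiset.card hRM
      have h4 : ∀ a : Fin 4, ((List.finRange 4).filter (· ≠ a)).length = 3 := by decide
      have h5 : (fib v u (separate b x y)).length = 3 := by
        rw [fib, List.length_map, h4]
      simp only [Multiset.coe_card, Multiset.card_add, List.length_cons, List.flatMap_cons,
        List.length_append, h5] at this
      omega

/-- Four vertices have only the partition into singletons, and it is a degenerate cycle because
`Step` is reflexive on nonempty sets. -/
theorem stirlingCycle_of_card (hc : W.card = 4) : StirlingCycle T W := by
  let e := W.equivFinOfCardEq hc
  let a : V → Fin 4 := fun s => if h : s ∈ W then e ⟨s, h⟩ else 0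
  have ha : ∀ s (hs : s ∈ W), a s = e ⟨s, hs⟩ := fun s hs => by simp [a, hs]
  have hinj : ∀ s ∈ W, ∀ s' ∈ W, (a s = a s' ↔ s = s') := by
    intro s hs s' hs'
    rw [ha s hs, ha s' hs', e.injective.eq_iff, Subtype.mk.injEq]
  obtain ⟨s₀, hs₀⟩ : W.Nonempty := Finset.card_pos.1 (by omega)
  refine ⟨a, [], ⟨?_, by simp, ?_⟩, ?_, Or.inl ⟨rfl, hc⟩⟩
  · intro f hf
    rw [List.mem_singleton] at hf
    subst hf
    refine ⟨fun s hs s' hs' h h' => h.ne ((hinj s hs s' hs').1 h'), fun c => ?_⟩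
    refine ⟨e.symm c, (e.symm c).2, ?_⟩
    rw [ha _ (e.symm c).2]
    simp
  · intro g hg
    refine ⟨a, by simp, fun s hs s' hs' => ?_⟩
    have hgi : Set.InjOn g W := by
      apply Finset.injOn_of_card_image_eq
      have : W.image g = Finset.univ := Finset.eq_univ_iff_forall.2 fun c => by
        obtain ⟨s, hs, hsc⟩ := hg.2 c
        exact Finset.mem_image.2 ⟨s, hs, hsc⟩
      rw [this, hc]; simp
    rw [hinj s hs s' hs', hgi.eq_iff hs hs']
  · simpa using Step.of_eq hs₀ fun _ _ _ => rfl

theorem IsSubtree.stirlingCycle (hW : IsSubtree T W) (hc : 4 ≤ W.card) : StirlingCycle T W := by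
  induction hW with
  | single r => simp at hc
  | @grow W v u hW h ih =>
    by_cases h4 : (insert v W).card = 4
    · exact stirlingCycle_of_card h4
    · have := Finset.card_insert_of_notMem h.notMem
      exact (ih (by omega)).grow hW (by omega) h

/-! ### From lists to Hamiltonian cycles -/

theorem exists_isHamiltonianCycle_of_list {α : Type*} [DecidableEq α] (G : SimpleGraph α) {a : α}
    {L : List α} (hnd : (a :: L).Nodup) (hall : ∀ x, x ∈ a :: L)
    (hch : (a :: (L ++ [a])).IsChain G.Adj) (hlen : 2 ≤ L.length) :
    ∃ (b : α) (C : G.Walk b b), C.IsHamiltonianCycle := by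
  obtain ⟨c, L, rfl⟩ : ∃ c L', L = c :: L' := by
    cases L with
    | nil => simp at hlen
    | cons a l => exact ⟨a, l, rfl⟩
  rw [← List.cons_append, List.isChain_append] at hch
  obtain ⟨hch, -, hlast⟩ := hch
  have hca := List.isChain_cons_cons.1 hch
  obtain ⟨b, q, hq, hb⟩ : ∃ b, ∃ q : G.Walk c b, q.support = c :: L ∧ (c :: L).getLast? = some b :=
    ⟨_, SimpleGraph.Walk.ofSupport (c :: L) (List.cons_ne_nil _ _) hca.2,
      SimpleGraph.Walk.support_ofSupport _ _,      List.getLast?_eq_some_getLast _⟩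
  have hba : G.Adj b a := hlast b (by rw [List.getLast?_cons_cons, hb]; rfl) a (by simp)
  refine ⟨b, SimpleGraph.Walk.cons hba (SimpleGraph.Walk.cons hca.1 q), ?_⟩
  rw [SimpleGraph.Walk.isHamiltonianCycle_iff_isCycle_and_support_count_tail_eq_one,
    SimpleGraph.Walk.cons_isCycle_iff]
  rw [List.nodup_cons] at hnd
  refine ⟨⟨?_, ?_⟩, fun x => ?_⟩
  · rw [SimpleGraph.Walk.isPath_def, SimpleGraph.Walk.support_cons, hq]
    exact List.nodup_cons.2 hnd
  · rw [SimpleGraph.Walk.edges_cons, List.mem_cons, not_or]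
    constructor
    -- The closing edge could equal the first edge only if `b = c`, which the length of the list
    -- rules out.
    · intro h
      have hbc : b = c := by
        rcases Sym2.eq_iff.1 h with ⟨rfl, _⟩ | ⟨h, _⟩
        · exact absurd rfl hba.ne
        · exact h
      subst hbc
      cases L with
      | nil => simp at hlen
      | cons d L =>
        rw [List.getLast?_cons_cons] at hb
        exact (List.nodup_cons.1 hnd.2).1 (List.mem_of_mem_getLast? hb)
    · intro h
      have := q.snd_mem_support_of_mem_edges h
      rw [hq] at this
      exact hnd.1 this
  · rw [SimpleGraph.Walk.support_cons, List.tail_cons, SimpleGraph.Walk.support_cons, hq]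
    exact List.count_eq_one_of_mem (List.nodup_cons.2 hnd) (hall x)

variable [Fintype V]

/-- The partition into the colour classes of `f`. -/
def cells (f : V → Fin k) : Finpartition (Finset.univ : Finset V) :=
  haveI : DecidableRel (Setoid.ker f).r := fun x y => inferInstanceAs (Decidable (f x = f y))
  Finpartition.ofSetoid (Setoid.ker f)

theorem mem_cells {f : V → Fin k} {s : Finset V} :
    s ∈ (cells f).parts ↔ ∃ a, Finset.univ.filter (fun x => f a = f x) = s := by
  simp only [cells, Finpartition.ofSetoid, Finpartition.ofSetSetoid_parts, Finset.mem_image, Finset.mem_univ, true_and]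
  exact Iff.rfl

theorem cells_inj {f g : V → Fin k} : cells f = cells g ↔ SameKer Finset.univ f g := by
  constructor
  · intro h x _ y _
    have hmem : ∀ a, Finset.univ.filter (fun x => f a = f x) =
        Finset.univ.filter (fun x => g a = g x) := by
      intro a
      have : Finset.univ.filter (fun x => f a = f x) ∈ (cells g).parts := h ▸ mem_cells.2 ⟨a, rfl⟩
      obtain ⟨c, hc⟩ := mem_cells.1 this
      have hca : a ∈ Finset.univ.filter (fun x => g c = g x) := by rw [hc]; simp
      have hca : g c = g a := by simpa using hca
      rw [← hc, hca]
    have := Finset.ext_iff.1 (hmem x) y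
    simpa using this
  · intro h
    ext s
    rw [mem_cells, mem_cells]
    refine exists_congr fun a => ?_
    rw [Finset.filter_congr fun x _ => h (Finset.mem_univ a) (Finset.mem_univ x)]

theorem avoid_cells_subset {f g : V → Fin k} {x : V} (h : SameKer (Finset.univ.erase x) f g) :
    ((cells f).avoid {x}).parts ⊆ ((cells g).avoid {x}).parts := by
  intro s hs
  obtain ⟨d, hd, hdx, rfl⟩ := (Finpartition.mem_avoid _).1 hs
  obtain ⟨a, rfl⟩ := mem_cells.1 hd
  obtain ⟨c, hc, hcx⟩ := Finset.not_subset.1 hdx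
  rw [Finset.mem_singleton] at hcx
  have hac : f a = f c := by simpa using hc
  refine (Finpartition.mem_avoid _).2 ⟨Finset.univ.filter (fun y => g c = g y),
    mem_cells.2 ⟨c, rfl⟩, ?_, ?_⟩
  · intro hsub
    exact hcx (Finset.mem_singleton.1 (hsub (by simp)))
  · ext y
    simp only [Finset.mem_sdiff, Finset.mem_filter, Finset.mem_univ, true_and,
      Finset.mem_singleton]
    refine and_congr_left fun hyx => ?_
    rw [hac]
    exact (h (by simp [hcx]) (by simp [hyx])).symm

theorem avoid_cells {f g : V → Fin k} {x : V} (h : SameKer (Finset.univ.erase x) f g) :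
    (cells f).avoid {x} = (cells g).avoid {x} :=
  Finpartition.ext (Finset.Subset.antisymm (avoid_cells_subset h) (avoid_cells_subset h.symm))

theorem card_cells {f : V → Fin k} (hf : ∀ c, ∃ x, f x = c) : (cells f).parts.card = k := by
  have hinj : Function.Injective fun c : Fin k => Finset.univ.filter (fun x => c = f x) := by
    intro c d h
    obtain ⟨x, rfl⟩ := hf c
    have := Finset.ext_iff.1 h x
    simpa [eq_comm] using this
  have : (cells f).parts = Finset.univ.image fun c : Fin k => Finset.univ.filter (fun x => c = f x) := by
    ext s
    rw [mem_cells]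
    simp only [Finset.mem_image, Finset.mem_univ, true_and]
    constructor
    · rintro ⟨a, rfl⟩
      exact ⟨f a, rfl⟩
    · rintro ⟨c, rfl⟩
      obtain ⟨a, rfl⟩ := hf c
      exact ⟨a, rfl⟩
  rw [this, Finset.card_image_of_injective _ hinj]
  simp

/-- The Stirling colouring whose cells are the colour classes of `f`. -/
def toStirling (f : V → Fin k) (hf : Onto T Finset.univ f) : StirlingColouring T k :=
  ⟨cells f, card_cells fun c => (hf.2 c).imp fun _ h => h.2, fun s hs => by
    obtain ⟨a, rfl⟩ := mem_cells.1 hs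
    intro x hx y hy _ hxy
    simp only [Finset.coe_filter, Finset.mem_univ, true_and, Set.mem_ofPred_eq] at hx hy
    exact hf.1 (Finset.mem_univ x) (Finset.mem_univ y) hxy (hx.symm.trans hy)⟩

theorem exists_toStirling (P : StirlingColouring T k) :
    ∃ (f : V → Fin k) (hf : Onto T Finset.univ f), toStirling f hf = P := by
  let e := P.1.parts.equivFinOfCardEq P.2.1
  let f : V → Fin k := fun x => e ⟨P.1.part x, P.1.part_mem.2 (Finset.mem_univ x)⟩
  have hf : ∀ x y, f x = f y ↔ P.1.part x = P.1.part y := by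
    intro x y
    simp only [f, e.injective.eq_iff, Subtype.mk.injEq]
  have hmem : ∀ x, x ∈ P.1.part x := fun x => P.1.mem_part (Finset.mem_univ x)
  have hpart : ∀ x y, P.1.part x = P.1.part y ↔ y ∈ P.1.part x := by
    intro x y
    constructor
    · intro h; rw [h]; exact hmem y
    · intro h
      exact (P.1.part_eq_of_mem (P.1.part_mem.2 (Finset.mem_univ x)) h).symm
  have honto : Onto T Finset.univ f := by
    constructor
    · intro x _ y _ hxy h
      rw [hf, hpart] at h
      exact P.2.2 _ (P.1.part_mem.2 (Finset.mem_univ x)) (hmem x) h hxy.ne hxy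
    · intro c
      obtain ⟨x, hx⟩ := P.1.nonempty_of_mem_parts (e.symm c).2
      refine ⟨x, Finset.mem_univ x, ?_⟩
      rw [← Equiv.eq_symm_apply]
      exact Subtype.ext (P.1.part_eq_of_mem (e.symm c).2 hx)
  refine ⟨f, honto, Subtype.ext (Finpartition.ext (Finset.ext fun s => ?_))⟩
  change s ∈ (cells f).parts ↔ _
  have hfil : ∀ a, Finset.univ.filter (fun x => f a = f x) = P.1.part a := by
    intro a
    ext x
    simp [hf, hpart]
  rw [mem_cells]
  constructor
  · rintro ⟨a, rfl⟩
    rw [hfil]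
    exact P.1.part_mem.2 (Finset.mem_univ a)
  · intro hs
    obtain ⟨a, ha⟩ := P.1.nonempty_of_mem_parts hs
    exact ⟨a, (hfil a).trans (P.1.part_eq_of_mem hs ha)⟩

theorem adj_toStirling {f g : V → Fin k} (hf : Onto T Finset.univ f) (hg : Onto T Finset.univ g)
    (hfg : Step Finset.univ f g) (hne : ¬ SameKer Finset.univ f g) :
    (stirlingColourGraph T k).Adj (toStirling f hf) (toStirling g hg) := by
  obtain ⟨x, -, h⟩ := hfg
  exact ⟨fun e => hne (cells_inj.1 (congrArg Subtype.val e)), x, avoid_cells h⟩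

/-- The four-Stirling colour graph of a tree with at least five vertices is Hamiltonian. -/
theorem exists_isHamiltonianCycle (T : SimpleGraph V)
    (hT : T.IsTree) (hV : 5 ≤ Fintype.card V) :
    ∃ (P : StirlingColouring T 4) (C : (stirlingColourGraph T 4).Walk P P),
      C.IsHamiltonianCycle := by
  classical
  obtain ⟨a, L, henum, hch, hlen⟩ := (isSubtree_univ hT).stirlingCycle
    (by rw [Finset.card_univ]; omega)
  -- Five vertices exclude the degenerate cycle.
  have hlen : 2 ≤ L.length := hlen.resolve_left fun h => by
    rw [Finset.card_univ] at h; omega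
  have ha := henum.mem a (by simp)
  let φ : (V → Fin 4) → StirlingColouring T 4 := fun f =>
    if hf : Onto T Finset.univ f then toStirling f hf else toStirling a ha
  have hφ : ∀ f (hf : Onto T Finset.univ f), φ f = toStirling f hf := fun f hf => dif_pos hf
  have hpw := List.pairwise_cons.1 henum.pairwise
  have hinj : ∀ f ∈ a :: L, ∀ g ∈ a :: L, φ f = φ g → SameKer Finset.univ f g := by
    intro f hf g hg h
    rw [hφ f (henum.mem f hf), hφ g (henum.mem g hg)] at h
    exact cells_inj.1 (congrArg Subtype.val h)
  have hadj : ∀ f ∈ a :: L, ∀ g ∈ a :: L, Step Finset.univ f g → ¬ SameKer Finset.univ f g →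
      (stirlingColourGraph T 4).Adj (φ f) (φ g) := by
    intro f hf g hg hfg hne
    rw [hφ f (henum.mem f hf), hφ g (henum.mem g hg)]
    exact adj_toStirling _ _ hfg hne
  refine exists_isHamiltonianCycle_of_list (stirlingColourGraph T 4) (a := φ a) (L := L.map φ)
    ?_ ?_ ?_ (by simpa using hlen)
  · rw [← List.map_cons, List.Nodup, List.pairwise_map]
    exact henum.pairwise.imp_of_mem fun hf hg hfg h => hfg (hinj _ hf _ hg h)
  · intro P
    obtain ⟨g, hg, rfl⟩ := exists_toStirling P
    obtain ⟨f, hf, hfg⟩ := henum.complete g hg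
    rw [← List.map_cons]
    refine List.mem_map.2 ⟨f, hf, ?_⟩
    rw [hφ f (henum.mem f hf)]
    exact Subtype.ext (cells_inj.2 hfg)
  · rw [← List.cons_append, List.isChain_append] at hch
    rw [← List.cons_append, ← List.map_cons, List.isChain_append]
    refine ⟨?_, by simp, ?_⟩
    · rw [List.isChain_map]
      have h1 := hch.1
      have h2 := henum.pairwise.isChain
      rw [List.isChain_iff_getElem] at h1 h2 ⊢
      exact fun i hi => hadj _ (List.getElem_mem _) _ (List.getElem_mem _) (h1 i hi) (h2 i hi)
    · intro P hP Q hQ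
      rw [List.getLast?_map, Option.mem_def, Option.map_eq_some_iff] at hP
      obtain ⟨f, hf, rfl⟩ := hP
      have hQ : Q = φ a := by simpa [eq_comm] using hQ
      subst hQ
      have hfL : f ∈ L := by
        cases L with
        | nil => simp at hlen
        | cons c L =>
          rw [List.getLast?_cons_cons] at hf
          exact List.mem_of_mem_getLast? hf
      exact hadj f (List.mem_cons_of_mem _ hfL) a (by simp) (hch.2.2 f hf a (by simp))
        fun h => hpw.1 f hfL h.symm

end StirlingGray

theorem mainTheorem4 {V : Type*} [Fintype V] [DecidableEq V] (T : SimpleGraph V)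
    (hT : T.IsTree) (hV : 5 ≤ Fintype.card V) :
    ∃ (P : StirlingColouring T 4) (C : (stirlingColourGraph T 4).Walk P P),
      C.IsHamiltonianCycle :=
  StirlingGray.exists_isHamiltonianCycle T hT hV
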